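/- **Setting.** Consider the colorful joint replenishment problem (CJRP) in which a general order is placed at every timestep. Such an instance consists of item types $[N]$, timesteps $[T]$, colors $[C]$, a set $D\subseteq[N]\times[T]$ of demand points (a demand point $d=(i,t)$ has item type $i$ and deadline $t$), item ordering costs $K_i\ge 0$, holding costs $H^{it}_s\in[0,\infty]$ that are non-increasing in $s\le t$, rejection penalties $p_d\ge 0$, weights $w^c_d\ge 0$ and rejection limits $R_c\in\mathbb R$ $(c\in[C])$. Its LP relaxation has variables $y^i_s,\ x^{it}_s\ (s\le t),\ r_{it}\ge 0$ and reads $$\min\ \sum_{i,s}K_iy^i_s+\sum_{(i,t)\in D}\sum_{s\le t}H^{it}_sx^{it}_s+\sum_{d\in D}p_dr_d$$ subject to $r_{it}+\sum_{s\le t}x^{it}_s\ge 1$ and $x^{it}_s\le y^i_s$ for all $(i,t)\in D$, $s\le t$, and $\sum_{d\in D}w^c_dr_d\le R_c$ for all $c\in[C]$ (the cost of the general orders is a constant, which is not counted). A solution is integral if all variables are in $\{0,1\}$; an optimal solution is a feasible integral solution of minimum cost. The number of replenishment orders of an integral solution is the number of timesteps $s$ with $y^i_s=1$ for some $i$. *Side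 information for $M$.* For some optimal solution, let $\mathcal G$ be a set of its $M$ most expensive item orders $(i,s)$, let $\mathcal S$ be a set of the $M$ demand points that it serves at the most expensive holding costs, and for $d\in\mathcal S$ let $\sigma(d)$ be a time at which it serves $d$. Let $K^M_{\max}$ be the smallest cost $K_i$ of an order $(i,s)\in\mathcal G$, and $H^M_{\max}$ the smallest $H^d_{\sigma(d)}$ over $d\in\mathcal S$. The augmented LP has the additional constraints $y^i_s=1$ for $(i,s)\in\mathcal G$; $y^i_s=0$ for $(i,s)\notin\mathcal G$ with $K_i>K^M_{\max}$; $x^d_{\sigma(d)}=1$ for $d\in\mathcal S$; and $x^d_s=0$ for $d\in D\setminus\mathcal S$ and $s$ with $H^d_s>H^M_{\max}$. **Theorem.** Let $p_d=0$ for all $d\in D$, let $\epsilon>0$, and let $M$ be a natural number such that - with $g(m)=(C+1)\frac{40C^2+90C^2\log m}{m}$ we have $g(m)\le\frac{\epsilon}{8}$ and $g'(m)<0$ for all real $m\ge M$, and $M>\frac{50C}{\epsilon}$; - every optimal solution has at least $M$ replenishment orders. Let $(\overline x,\overline y,\overline r)$ be any feasible solution, of cost $\mathsf{LP}^1$, of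 the LP augmented with side information for $M$. Then there is an integral solution $(x,y,r)$ of the augmented LP (in particular, of the instance) of cost at most $(1+\frac{\epsilon}{8})\,\mathsf{LP}^1$ such that, for every $d\in D$, $r_d=0$ if $\overline r_d=0$, and $r_d=1$ if $\overline r_d=1$. -/

import Mathlib

open scoped NNReal ENNReal

/-- An instance of the colorful joint replenishment problem with item types `Fin N`, timesteps
`Fin T` and colors `Fin C`, in which a general order is placed at every timestep.  The general
orders are therefore constants: neither the variables `y_s` nor their fixed cost appear.
A demand point is a pair `(i, t)` of an item type and a deadline.  Holding costs may be infinite. -/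
structure CJRP (N T C : ℕ) where
  /-- the set of demand points -/
  D : Finset (Fin N × Fin T)
  /-- item ordering costs -/
  K : Fin N → ℝ≥0
  /-- `H d s` is the holding cost of serving `d` at time `s`; only `s ≤ d.2` matters -/
  H : Fin N × Fin T → Fin T → ℝ≥0∞
  /-- serving a demand point later, but by its deadline, is not more expensive -/
  H_antitone : ∀ d ∈ D, ∀ s s' : Fin T, s ≤ s' → s' ≤ d.2 → H d s' ≤ H d s
  /-- rejection penalties -/
  p : Fin N × Fin T → ℝ≥0
  /-- `w c d` is the weight of demand point `d` in color `c` -/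
  w : Fin C → Fin N × Fin T → ℝ≥0
  /-- rejection weight limit of each color -/
  R : Fin C → ℝ

/-- An assignment of values to the variables `y^i_s`, `x^d_s`, `r_d`.
The values of `x` and `r` at pairs that are not demand points are never used. -/
structure CJRPVars (N T : ℕ) where
  y : Fin N → Fin T → ℝ
  x : Fin N × Fin T → Fin T → ℝ
  r : Fin N × Fin T → ℝ

/-- All variables are `0` or `1`. -/
structure CJRPVars.IsIntegral {N T : ℕ} (z : CJRPVars N T) (D : Finset (Fin N × Fin T)) :
    Prop where
  y_int : ∀ i s, z.y i s = 0 ∨ z.y i s = 1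
  x_int : ∀ d ∈ D, ∀ s, z.x d s = 0 ∨ z.x d s = 1
  r_int : ∀ d ∈ D, z.r d = 0 ∨ z.r d = 1

open Classical in
/-- The number of (nonempty) replenishment orders of an integral solution: the number of timesteps
at which some item is ordered. -/
noncomputable def CJRPVars.numOrders {N T : ℕ} (z : CJRPVars N T) : ℕ :=
  (Finset.univ.filter fun s : Fin T => ∃ i, z.y i s = 1).card

namespace CJRP

variable {N T C : ℕ}

/-- Feasibility for the LP relaxation. -/
structure Feasible (I : CJRP N T C) (z : CJRPVars N T) : Prop where
  y_nonneg : ∀ i s, 0 ≤ z.y i s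
  x_nonneg : ∀ d ∈ I.D, ∀ s, 0 ≤ z.x d s
  r_nonneg : ∀ d ∈ I.D, 0 ≤ z.r d
  /-- no service after the deadline -/
  deadline : ∀ d ∈ I.D, ∀ s, d.2 < s → z.x d s = 0
  /-- reject or service every demand -/
  cover : ∀ d ∈ I.D, 1 ≤ z.r d + ∑ s ∈ Finset.Iic d.2, z.x d s
  /-- servicing requires an item order -/
  item_order : ∀ d ∈ I.D, ∀ s, z.x d s ≤ z.y d.1 s
  /-- rejection bound for each color -/
  reject : ∀ c, ∑ d ∈ I.D, (I.w c d : ℝ) * z.r d ≤ I.R c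

/-- The objective: item ordering cost, plus holding cost, plus rejection penalties
(with the convention `0 * ∞ = 0`). -/
noncomputable def cost (I : CJRP N T C) (z : CJRPVars N T) : ℝ≥0∞ :=
  (∑ i, ∑ s, (I.K i : ℝ≥0∞) * ENNReal.ofReal (z.y i s))
    + (∑ d ∈ I.D, ∑ s ∈ Finset.Iic d.2, I.H d s * ENNReal.ofReal (z.x d s))
    + ∑ d ∈ I.D, (I.p d : ℝ≥0∞) * ENNReal.ofReal (z.r d)

/-- `z` is an optimal (integral) solution of the instance. -/
structure IsOptimal (I : CJRP N T C) (z : CJRPVars N T) : Prop where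
  feasible : I.Feasible z
  integral : z.IsIntegral I.D
  le_cost : ∀ z' : CJRPVars N T, I.Feasible z' → z'.IsIntegral I.D → I.cost z ≤ I.cost z'

/-- Side information: a set of guessed item orders `(i, s)`, and a set of guessed demand points,
each with a guessed time of service. -/
structure SideInfo (N T : ℕ) where
  orders : Finset (Fin N × Fin T)
  demands : Finset (Fin N × Fin T)
  time : Fin N × Fin T → Fin T

/-- The side information is correct for the parameter `M`: for some optimal solution `z`, it
consists of the `M` most expensive item orders of `z` and of the `M` demand points that `z` serves
at the most expensive holding costs, with the times at which `z` serves them. -/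
def SideInfo.IsCorrect (G : SideInfo N T) (I : CJRP N T C) (M : ℕ) : Prop :=
  ∃ z : CJRPVars N T, I.IsOptimal z ∧
    G.orders.card = M ∧
    (∀ e ∈ G.orders, z.y e.1 e.2 = 1) ∧
    (∀ i s, z.y i s = 1 → (i, s) ∉ G.orders → ∀ e ∈ G.orders, I.K i ≤ I.K e.1) ∧
    G.demands ⊆ I.D ∧
    G.demands.card = M ∧
    (∀ d ∈ G.demands, z.x d (G.time d) = 1) ∧
    (∀ d ∈ I.D, d ∉ G.demands → ∀ s, z.x d s = 1 →
      ∀ d' ∈ G.demands, I.H d s ≤ I.H d' (G.time d'))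

/-- Feasibility for the LP relaxation augmented with the side information `G`. -/
structure AugFeasible (I : CJRP N T C) (G : SideInfo N T) (z : CJRPVars N T) : Prop where
  feasible : I.Feasible z
  /-- the guessed item orders are placed -/
  order_one : ∀ e ∈ G.orders, z.y e.1 e.2 = 1
  /-- no other order of an item that costs more than the cheapest guessed item order -/
  order_zero : ∀ i s, (i, s) ∉ G.orders → (∃ e ∈ G.orders, I.K e.1 < I.K i) → z.y i s = 0
  /-- the guessed demand points are served at the guessed times -/
  serve_one : ∀ d ∈ G.demands, z.x d (G.time d) = 1
  /-- for the other demand points, service at a holding cost that exceeds the smallest guessed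
  holding cost is forbidden (its holding cost counts as infinite) -/
  serve_zero : ∀ d ∈ I.D, d ∉ G.demands → ∀ s ≤ d.2,
    (∃ d' ∈ G.demands, I.H d' (G.time d') < I.H d s) → z.x d s = 0

/-- `g(m) = (C+1) (40 C² + 90 C² log m) / m`. -/
noncomputable def g (C : ℕ) (m : ℝ) : ℝ :=
  ((C : ℝ) + 1) * ((40 * (C : ℝ) ^ 2 + 90 * (C : ℝ) ^ 2 * Real.log m) / m)

end CJRP

/-! With the general orders given, items interact only through the `C` color constraints. For one
item, place an order whenever the cumulative mass of `y`, shifted by a uniform `θ`, passes an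
integer. This random order set has marginals `y` and meets an interval of timesteps with probability
at least the minimum of 1 and its mass. So each demand can be served by the latest order up to its
deadline with total probability `1 - r`, at no more than its fractional holding cost
(`exists_service_by_latest_order`). In expectation nothing is lost; the rest is derandomization.

A basic solution preserves the `C` color sums and uses only `C` options beyond one per mixture; all
options in use are then adopted together. Over the whole horizon an extra option could double the
cost of an item, so the time of each item is cut into `2 ^ k` blocks of similar mass, where an extra
option costs about a `2 ^ k`-th of the ordering cost. Following a new order set from some block on
costs one more order, the last earlier one of that set (`exists_mergedOrders_service`). Building the
mixtures by `k` successive halvings of the blocks keeps the number of such changes below `5 * C * k`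
(`exists_dyadic_mixtures`). A final basic solution leaves at most `C` demands fractional, and these
are served (`exists_served_demands`).

The side information prices the extras: an additional order from a change costs at most the cheapest
guessed order, hence at most a fraction `1 / M` of the ordering cost, since dearer items are already
integral; likewise for an additional service. With `2 ^ k` just above `M`, the loss is at most `(9 *
C + 5 * C * k) / M` times the LP cost. -/

/-! ### Basic solutions and sparse mixtures -/

/-- While the support exceeds the number of equations, some nonzero direction on it lies in their
kernel. Moving along it, with the sign that does not raise the cost, makes a coordinate vanish. -/
theorem exists_nonneg_solution_card_support_le {ι ρ : Type*} [DecidableEq ι] (s : Finset ι)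
    (R : Finset ρ) (A : ρ → ι → ℝ) (c : ι → ℝ) (hc : ∀ i ∈ s, 0 ≤ c i) (f : ι → ℝ)
    (hf : ∀ i ∈ s, 0 ≤ f i) :
    ∃ f' : ι → ℝ, (∀ i ∈ s, 0 ≤ f' i) ∧ (∀ i ∈ s, f i = 0 → f' i = 0) ∧
      (∀ r ∈ R, ∑ i ∈ s, A r i * f' i = ∑ i ∈ s, A r i * f i) ∧
      ∑ i ∈ s, c i * f' i ≤ ∑ i ∈ s, c i * f i ∧
      (s.filter fun i => f' i ≠ 0).card ≤ R.card := by
  induction h : (s.filter fun i => f i ≠ 0).card using Nat.strong_induction_on generalizing f with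
  | _ n ih =>
  subst h
  by_cases hle : (s.filter fun i => f i ≠ 0).card ≤ R.card
  · exact ⟨f, hf, fun _ _ h => h, fun _ _ => rfl, le_rfl, hle⟩
  push Not at hle
  set S := s.filter fun i => f i ≠ 0 with hS
  have hSs : S ⊆ s := Finset.filter_subset _ _
  have hpos : ∀ i ∈ S, 0 < f i := fun i hi =>
    lt_of_le_of_ne (hf i (hSs hi)) (Ne.symm (Finset.mem_filter.1 hi).2)
  -- a nonzero direction in the kernel
  obtain ⟨e, he0, heA⟩ : ∃ e : ι → ℝ, (∃ i ∈ S, e i ≠ 0) ∧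
      ∀ r ∈ R, ∑ i ∈ S, A r i * e i = 0 := by
    let φ : (S → ℝ) →ₗ[ℝ] (R → ℝ) :=
      { toFun := fun e r => ∑ i : S, A r i * e i
        map_add' := by
          intro a b; ext r; simp [mul_add, Finset.sum_add_distrib]
        map_smul' := by
          intro a b; ext r
          simp only [Pi.smul_apply, smul_eq_mul, RingHom.id_apply, Finset.mul_sum]
          exact Finset.sum_congr rfl fun i _ => by ring }
    have hker : LinearMap.ker φ ≠ ⊥ := LinearMap.ker_ne_bot_of_finrank_lt (by simpa using hle)
    obtain ⟨e, he, hne⟩ := Submodule.exists_mem_ne_zero_of_ne_bot hker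
    obtain ⟨j, hj⟩ := Function.ne_iff.1 hne
    refine ⟨fun i => if hi : i ∈ S then e ⟨i, hi⟩ else 0, ⟨j, j.2, by simpa using hj⟩, ?_⟩
    intro r hr
    have := congrFun (LinearMap.mem_ker.1 he) ⟨r, hr⟩
    rw [← Finset.sum_coe_sort S]
    simpa [φ] using this
  -- orient it
  obtain ⟨e, ⟨j, hj, hjneg⟩, heA, hec⟩ : ∃ e : ι → ℝ, (∃ i ∈ S, e i < 0) ∧
      (∀ r ∈ R, ∑ i ∈ S, A r i * e i = 0) ∧ ∑ i ∈ S, c i * e i ≤ 0 := by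
    -- As `c` is nonnegative, a direction of decreasing cost has a negative entry, so the move along
    -- it is bounded.
    have hneg : ∀ e : ι → ℝ, ∑ i ∈ S, c i * e i < 0 → ∃ i ∈ S, e i < 0 := by
      intro e h
      by_contra! hcon
      exact absurd h (not_lt.2 (Finset.sum_nonneg fun i hi =>
        mul_nonneg (hc i (hSs hi)) (hcon i hi)))
    have hA' : ∀ r ∈ R, ∑ i ∈ S, A r i * (-e i) = 0 := fun r hr => by
      simp [heA r hr]
    have hcn : ∑ i ∈ S, c i * (-e i) = -∑ i ∈ S, c i * e i := by simp
    rcases lt_trichotomy (∑ i ∈ S, c i * e i) 0 with h | h | h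
    · exact ⟨e, hneg e h, heA, h.le⟩
    · obtain ⟨i, hi, hne⟩ := he0
      rcases lt_or_gt_of_ne hne with h' | h'
      · exact ⟨e, ⟨i, hi, h'⟩, heA, h.le⟩
      · exact ⟨fun i => -e i, ⟨i, hi, by simpa using h'⟩, hA', by rw [hcn, h]; simp⟩
    · have h' : ∑ i ∈ S, c i * (-e i) < 0 := by rw [hcn]; linarith
      exact ⟨fun i => -e i, hneg _ h', hA', h'.le⟩
  -- Ratio test: `m` is the first coordinate to reach zero.
  obtain ⟨m, hm, hmin⟩ := Finset.exists_min_image (S.filter fun i => e i < 0)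
    (fun i => f i / (-e i)) ⟨j, Finset.mem_filter.2 ⟨hj, hjneg⟩⟩
  obtain ⟨hmS, hmneg⟩ := Finset.mem_filter.1 hm
  set t := f m / (-e m) with ht
  have ht0 : 0 ≤ t := div_nonneg (hpos m hmS).le (by linarith)
  let f₁ : ι → ℝ := fun i => if i ∈ S then f i + t * e i else 0
  have hf₁ : ∀ i ∈ s, 0 ≤ f₁ i := by
    intro i _
    by_cases hi : i ∈ S
    · simp only [f₁, hi, if_true]
      by_cases hei : e i < 0
      · have := hmin i (Finset.mem_filter.2 ⟨hi, hei⟩)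
        rw [le_div_iff₀ (by linarith)] at this
        linarith
      · have := mul_nonneg ht0 (not_lt.1 hei)
        linarith [hpos i hi]
    · simp [f₁, hi]
  have hf₁0 : ∀ i ∈ s, f i = 0 → f₁ i = 0 := by
    intro i _ h
    have : i ∉ S := fun hi => (Finset.mem_filter.1 hi).2 h
    simp [f₁, this]
  have hsum : ∀ a : ι → ℝ, ∑ i ∈ s, a i * f₁ i = ∑ i ∈ s, a i * f i + t * ∑ i ∈ S, a i * e i := by
    intro a
    have h1 : ∑ i ∈ s, a i * f i = ∑ i ∈ S, a i * f i := by
      symm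
      apply Finset.sum_subset hSs
      intro i hi hiS
      have : f i = 0 := by
        by_contra h
        exact hiS (Finset.mem_filter.2 ⟨hi, h⟩)
      simp [this]
    have h2 : ∑ i ∈ s, a i * f₁ i = ∑ i ∈ S, a i * f₁ i := by
      symm
      apply Finset.sum_subset hSs
      intro i _ hiS
      simp [f₁, hiS]
    rw [h1, h2, Finset.mul_sum, ← Finset.sum_add_distrib]
    refine Finset.sum_congr rfl fun i hi => ?_
    simp only [f₁, hi, if_true]
    ring
  have hlt : (s.filter fun i => f₁ i ≠ 0).card < S.card := by
    apply Finset.card_lt_card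
    rw [Finset.ssubset_iff_of_subset]
    · refine ⟨m, hmS, ?_⟩
      simp only [Finset.mem_filter, not_and, not_not]
      intro _
      simp only [f₁, hmS, if_true, ht]
      field_simp [hmneg.ne]
      ring
    · intro i hi
      by_contra h
      exact (Finset.mem_filter.1 hi).2 (by simp [f₁, h])
  obtain ⟨f', h1, h2, h3, h4, h5⟩ := ih _ hlt f₁ hf₁ rfl
  refine ⟨f', h1, fun i hi h => h2 i hi (hf₁0 i hi h), fun r hr => ?_, ?_, h5⟩
  · rw [h3 r hr, hsum, heA r hr]; simp
  · refine h4.trans ?_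
    rw [hsum]
    nlinarith

/-- The options that a mixture uses. -/
noncomputable def mixSupport {O : Type*} [Fintype O] (p : O → ℝ) : Finset O :=
  open Classical in Finset.univ.filter fun o => p o ≠ 0

theorem mem_mixSupport {O : Type*} [Fintype O] {p : O → ℝ} {o : O} :
    o ∈ mixSupport p ↔ p o ≠ 0 := by
  simp [mixSupport]

theorem mixSupport_nonempty {O : Type*} [Fintype O] {p : O → ℝ} (h : ∑ o, p o = 1) :
    (mixSupport p).Nonempty := by
  by_contra hne
  rw [Finset.not_nonempty_iff_eq_empty] at hne
  have : ∀ o, p o = 0 := fun o => by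
    by_contra ho
    have := mem_mixSupport.2 ho
    rw [hne] at this
    simp at this
  simp [this] at h

/-- The number of options of a mixture beyond the first. -/
noncomputable def mixExcess {O : Type*} [Fintype O] (p : O → ℝ) : ℕ :=
  (mixSupport p).card - 1

theorem card_mixSupport {O : Type*} [Fintype O] {p : O → ℝ} (h : ∑ o, p o = 1) :
    (mixSupport p).card = 1 + mixExcess p := by
  have := (mixSupport_nonempty h).card_pos
  unfold mixExcess
  omega

/-- Given finitely many mixtures, one can preserve `card κ` linear functionals and not increase a
cost while the mixtures use only `card κ` options beyond one for each mixture. -/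
theorem exists_sparse_mixtures {γ O κ : Type*} [Fintype O] [Fintype κ] (Γ : Finset γ)
    (v : κ → γ → O → ℝ) (c : γ → O → ℝ) (hc : ∀ g ∈ Γ, ∀ o, 0 ≤ c g o) (f : γ → O → ℝ)
    (hf : ∀ g ∈ Γ, ∀ o, 0 ≤ f g o) (hsum : ∀ g ∈ Γ, ∑ o, f g o = 1) :
    ∃ f' : γ → O → ℝ, (∀ g ∈ Γ, ∀ o, 0 ≤ f' g o) ∧ (∀ g ∈ Γ, ∑ o, f' g o = 1) ∧
      (∀ g ∈ Γ, ∀ o, f g o = 0 → f' g o = 0) ∧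
      (∀ j, ∑ g ∈ Γ, ∑ o, v j g o * f' g o = ∑ g ∈ Γ, ∑ o, v j g o * f g o) ∧
      ∑ g ∈ Γ, ∑ o, c g o * f' g o ≤ ∑ g ∈ Γ, ∑ o, c g o * f g o ∧
      ∑ g ∈ Γ, mixExcess (f' g) ≤ Fintype.card κ := by
  classical
  -- One normalization row per mixture and one row per functional. Every mixture uses at least one
  -- option, so the normalization rows pay for these and `card κ` remains for the excess.
  let A : γ ⊕ κ → γ × O → ℝ := fun r e =>
    Sum.elim (fun g => if e.1 = g then 1 else 0) (fun j => v j e.1 e.2) r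
  obtain ⟨F, h1, h2, h3, h4, h5⟩ := exists_nonneg_solution_card_support_le
    (Γ ×ˢ (Finset.univ : Finset O)) (Γ.disjSum (Finset.univ : Finset κ)) A
    (fun e => c e.1 e.2) (fun e he => hc _ (Finset.mem_product.1 he).1 _)
    (fun e => f e.1 e.2) (fun e he => hf _ (Finset.mem_product.1 he).1 _)
  have hA : ∀ (F : γ × O → ℝ), ∀ g ∈ Γ,
      ∑ e ∈ Γ ×ˢ (Finset.univ : Finset O), A (Sum.inl g) e * F e = ∑ o, F (g, o) := by
    intro F g hg
    rw [Finset.sum_product, Finset.sum_eq_single g]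
    · simp [A]
    · intro b _ hb
      simp [A, hb]
    · exact fun h => absurd hg h
  have hs1 : ∀ g ∈ Γ, ∑ o, F (g, o) = 1 := by
    intro g hg
    rw [← hA F g hg, h3 _ (Finset.inl_mem_disjSum.2 hg), hA _ g hg, hsum g hg]
  refine ⟨fun g o => F (g, o), fun g hg o => h1 _ (by simp [hg]), hs1,
    fun g hg o => h2 (g, o) (by simp [hg]), fun j => ?_, ?_, ?_⟩
  · have := h3 (Sum.inr j) (Finset.inr_mem_disjSum.2 (Finset.mem_univ j))
    rw [Finset.sum_product, Finset.sum_product] at this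
    simpa [A] using this
  · rw [Finset.sum_product, Finset.sum_product] at h4
    exact h4
  · have h6 : ((Γ ×ˢ (Finset.univ : Finset O)).filter fun e => F e ≠ 0).card =
        ∑ g ∈ Γ, (mixSupport fun o => F (g, o)).card := by
      rw [Finset.card_filter, Finset.sum_product]
      refine Finset.sum_congr rfl fun g _ => ?_
      rw [mixSupport, Finset.card_filter]
    rw [h6, Finset.card_disjSum, Finset.sum_congr rfl fun g hg => card_mixSupport (hs1 g hg),
      Finset.sum_add_distrib] at h5
    simp only [Finset.sum_const, smul_eq_mul, mul_one, Finset.card_univ] at h5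
    exact Nat.le_of_add_le_add_left h5

/-! ### Dyadic refinement of mixtures -/

theorem sum_range_two_mul {β : Type*} [AddCommMonoid β] (g : ℕ → β) (m : ℕ) :
    ∑ b ∈ Finset.range (2 * m), g b = ∑ a ∈ Finset.range m, (g (2 * a) + g (2 * a + 1)) := by
  induction m with
  | zero => simp
  | succ m ih =>
    rw [show 2 * (m + 1) = 2 * m + 1 + 1 by ring, Finset.sum_range_succ, Finset.sum_range_succ, ih,
      Finset.sum_range_succ, add_assoc]

/-- The factor 2 is due to truncated subtraction, which counts `e 0` twice. -/
theorem sum_range_pred_le (e : ℕ → ℕ) (m : ℕ) :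
    ∑ a ∈ Finset.range m, e (a - 1) ≤ 2 * ∑ a ∈ Finset.range m, e a := by
  cases m with
  | zero => simp
  | succ m =>
    rw [Finset.sum_range_succ']
    simp only [add_tsub_cancel_right, zero_tsub]
    have h1 : ∑ a ∈ Finset.range m, e a ≤ ∑ a ∈ Finset.range (m + 1), e a :=
      Finset.sum_le_sum_of_subset (Finset.range_subset_range.2 (Nat.le_succ m))
    have h2 : e 0 ≤ ∑ a ∈ Finset.range (m + 1), e a :=
      Finset.single_le_sum (fun _ _ => Nat.zero_le _) (by simp)
    omega

/-- A deterministic mixture cannot change when it is made sparser; this limits the changes caused by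
a refinement. -/
theorem mixSupport_eq_of_excess_zero {O : Type*} [Fintype O] {p q : O → ℝ} (hp : ∑ o, p o = 1)
    (hq : ∑ o, q o = 1) (hpq : ∀ o, p o = 0 → q o = 0) (he : mixExcess p = 0) :
    mixSupport q = mixSupport p := by
  apply Finset.eq_of_subset_of_card_le
  · intro o ho
    rw [mem_mixSupport] at ho ⊢
    exact fun h => ho (hpq o h)
  · rw [card_mixSupport hp, card_mixSupport hq, he]
    omega

open Classical in
/-- Mixtures of options, one for each `x`, can be replaced by mixtures for each of `2 ^ k`
consecutive blocks, which use few options, and few options that the block before does not use. -/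
theorem exists_dyadic_mixtures {X O κ : Type*} [Fintype X] [Fintype O] [Fintype κ]
    (w : X → O → ℝ) (hw0 : ∀ x o, 0 ≤ w x o) (hw1 : ∀ x, ∑ o, w x o = 1) (k : ℕ)
    (v : κ → X → ℕ → O → ℝ) (c : X → ℕ → O → ℝ) (hc : ∀ x b o, 0 ≤ c x b o) :
    ∃ f : X → ℕ → O → ℝ, (∀ x, ∀ b < 2 ^ k, ∀ o, 0 ≤ f x b o) ∧
      (∀ x, ∀ b < 2 ^ k, ∑ o, f x b o = 1) ∧
      (∀ x, ∀ b < 2 ^ k, ∀ o, w x o = 0 → f x b o = 0) ∧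
      (∀ j, ∑ x, ∑ b ∈ Finset.range (2 ^ k), ∑ o, v j x b o * f x b o =
        ∑ x, ∑ b ∈ Finset.range (2 ^ k), ∑ o, v j x b o * w x o) ∧
      ∑ x, ∑ b ∈ Finset.range (2 ^ k), ∑ o, c x b o * f x b o ≤
        ∑ x, ∑ b ∈ Finset.range (2 ^ k), ∑ o, c x b o * w x o ∧
      ∑ x, ∑ b ∈ Finset.range (2 ^ k), mixExcess (f x b) ≤ Fintype.card κ ∧
      ∑ x, ∑ b ∈ Finset.range (2 ^ k), (mixSupport (f x b) \ mixSupport (f x (b - 1))).card ≤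
        5 * Fintype.card κ * k := by
  induction k generalizing v c with
  | zero =>
    obtain ⟨f, h1, h2, h3, h4, h5, h6⟩ := exists_sparse_mixtures (Finset.univ : Finset X)
      (fun j x o => v j x 0 o) (fun x o => c x 0 o) (fun x _ o => hc x 0 o) w
      (fun x _ o => hw0 x o) (fun x _ => hw1 x)
    refine ⟨fun x _ o => f x o, fun x _ _ => h1 x (Finset.mem_univ x),
      fun x _ _ => h2 x (Finset.mem_univ x), fun x _ _ => h3 x (Finset.mem_univ x), ?_, ?_, ?_, ?_⟩
    · simpa using h4
    · simpa using h5
    · simpa using h6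
    · simp
  | succ k ih =>
    -- A block of level `k` carries the sum of the functionals and costs of its two halves.
    obtain ⟨f, h1, h2, h3, h4, h5, h6, h7⟩ := ih
      (fun j x b o => v j x (2 * b) o + v j x (2 * b + 1) o)
      (fun x b o => c x (2 * b) o + c x (2 * b + 1) o)
      (fun x b o => add_nonneg (hc _ _ _) (hc _ _ _))
    have hhalf : ∀ b < 2 ^ (k + 1), b / 2 < 2 ^ k := fun b hb => by
      rw [pow_succ] at hb
      omega
    -- Both halves inherit the mixture of their parent and are made sparse again.
    obtain ⟨F, H1, H2, H3, H4, H5, H6⟩ := exists_sparse_mixtures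
      ((Finset.univ : Finset X) ×ˢ Finset.range (2 ^ (k + 1)))
      (fun j e o => v j e.1 e.2 o) (fun e o => c e.1 e.2 o) (fun e _ o => hc _ _ _)
      (fun e o => f e.1 (e.2 / 2) o)
      (fun e he o => h1 _ _ (hhalf _ (by simpa using he)) _)
      (fun e he => h2 _ _ (hhalf _ (by simpa using he)))
    simp only [Finset.sum_product] at H4 H5 H6
    have hmem : ∀ x, ∀ b < 2 ^ (k + 1),
        (x, b) ∈ (Finset.univ : Finset X) ×ˢ Finset.range (2 ^ (k + 1)) := by simp
    have hsplit : ∀ a : X → ℕ → O → ℝ, ∀ g : X → ℕ → O → ℝ,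
        ∑ x, ∑ b ∈ Finset.range (2 ^ (k + 1)), ∑ o, a x b o * g x (b / 2) o =
        ∑ x, ∑ b ∈ Finset.range (2 ^ k), ∑ o, (a x (2 * b) o + a x (2 * b + 1) o) * g x b o := by
      intro a g
      refine Finset.sum_congr rfl fun x _ => ?_
      rw [pow_succ, mul_comm, sum_range_two_mul]
      refine Finset.sum_congr rfl fun b _ => ?_
      rw [← Finset.sum_add_distrib]
      refine Finset.sum_congr rfl fun o _ => ?_
      rw [show (2 * b + 1) / 2 = b by omega, show 2 * b / 2 = b by omega]
      ring
    refine ⟨fun x b o => F (x, b) o, fun x b hb o => H1 _ (hmem x b hb) o,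
      fun x b hb => H2 _ (hmem x b hb),
      fun x b hb o ho => H3 _ (hmem x b hb) o (h3 x _ (hhalf b hb) o ho), fun j => ?_, ?_, H6, ?_⟩
    · rw [H4 j, hsplit (v j) f, h4 j]
      exact (hsplit (v j) fun x _ o => w x o).symm
    · refine H5.trans ?_
      rw [hsplit c f]
      exact h5.trans (hsplit c fun x _ o => w x o).ge
    · have hsame : ∀ x, ∀ b < 2 ^ (k + 1), mixExcess (f x (b / 2)) = 0 →
          mixSupport (F (x, b)) = mixSupport (f x (b / 2)) := fun x b hb he =>
        mixSupport_eq_of_excess_zero (h2 x _ (hhalf b hb)) (H2 _ (hmem x b hb))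
          (H3 _ (hmem x b hb)) he
      have hcrude : ∀ x, ∀ b < 2 ^ (k + 1), ∀ S : Finset O,
          (mixSupport (F (x, b)) \ S).card ≤ 1 + mixExcess (F (x, b)) := fun x b hb S => by
        rw [← card_mixSupport (H2 _ (hmem x b hb))]
        exact Finset.card_le_card Finset.sdiff_subset
      -- Where the parents involved are deterministic, no change is added. Elsewhere the crude bound
      -- `1 + mixExcess` applies, with the 1 charged to a parent of positive excess. Each parent
      -- pays for its two halves and for the left half of its successor, so a level adds at most `1
      -- + 4` times `card κ`. For `b = 0`, `b - 1 = 0` and nothing is counted.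
      have hx : ∀ x, ∑ b ∈ Finset.range (2 ^ (k + 1)),
          (mixSupport (F (x, b)) \ mixSupport (F (x, b - 1))).card ≤
          ∑ b ∈ Finset.range (2 ^ k), (mixSupport (f x b) \ mixSupport (f x (b - 1))).card +
          ∑ b ∈ Finset.range (2 ^ (k + 1)), mixExcess (F (x, b)) +
          4 * ∑ b ∈ Finset.range (2 ^ k), mixExcess (f x b) := by
        intro x
        have hpred := sum_range_pred_le (fun a => mixExcess (f x a)) (2 ^ k)
        rw [pow_succ, mul_comm, sum_range_two_mul, sum_range_two_mul]
        refine le_trans (b := ∑ a ∈ Finset.range (2 ^ k),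
          ((mixSupport (f x a) \ mixSupport (f x (a - 1))).card +
            (mixExcess (F (x, 2 * a)) + mixExcess (F (x, 2 * a + 1))) +
            2 * mixExcess (f x a) + mixExcess (f x (a - 1)))) ?_ ?_
        · refine Finset.sum_le_sum fun a ha => ?_
          have ha' : 2 * a + 1 < 2 ^ (k + 1) := by
            rw [Finset.mem_range] at ha
            rw [pow_succ]
            omega
          have e1 : (2 * a + 1) / 2 = a := by omega
          have e2 : 2 * a / 2 = a := by omega
          have e3 : (2 * a - 1) / 2 = a - 1 := by omega
          have odd : (mixSupport (F (x, 2 * a + 1)) \ mixSupport (F (x, 2 * a + 1 - 1))).card ≤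
              mixExcess (F (x, 2 * a + 1)) + mixExcess (f x a) := by
            by_cases he : mixExcess (f x a) = 0
            · rw [hsame x _ ha' (by rw [e1]; exact he), Nat.add_sub_cancel,
                hsame x (2 * a) (by omega) (by rw [e2]; exact he), e1, e2]
              simp
            · have := hcrude x _ ha' (mixSupport (F (x, 2 * a + 1 - 1)))
              omega
          have even : (mixSupport (F (x, 2 * a)) \ mixSupport (F (x, 2 * a - 1))).card ≤
              (mixSupport (f x a) \ mixSupport (f x (a - 1))).card +
              mixExcess (F (x, 2 * a)) + mixExcess (f x a) + mixExcess (f x (a - 1)) := by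
            by_cases he : mixExcess (f x a) = 0 ∧ mixExcess (f x (a - 1)) = 0
            · rw [hsame x (2 * a) (by omega) (by rw [e2]; exact he.1),
                hsame x (2 * a - 1) (by omega) (by rw [e3]; exact he.2), e2, e3]
              omega
            · have := hcrude x (2 * a) (by omega) (mixSupport (F (x, 2 * a - 1)))
              omega
          omega
        · simp only [Finset.sum_add_distrib, ← Finset.mul_sum]
          omega
      refine (Finset.sum_le_sum fun x _ => hx x).trans ?_
      simp only [Finset.sum_add_distrib, ← Finset.mul_sum]
      have : 5 * Fintype.card κ * (k + 1) = 5 * Fintype.card κ * k + 5 * Fintype.card κ := by ring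
      omega

/-! ### Systematic rounding -/

open MeasureTheory in
/-- A random element of a finite type, driven by a uniform `θ`, as an explicit mixture. -/
theorem exists_mixture_of_uniform {α : Type*} [Fintype α] (X : ℝ → α)
    (hX : ∀ a, MeasurableSet {θ | X θ = a}) :
    ∃ w : α → ℝ, (∀ a, 0 ≤ w a) ∧ (∀ a, w a ≠ 0 → ∃ θ, X θ = a) ∧
      ∀ Φ : α → ℝ, ∑ a, w a * Φ a = ∫ θ in (0 : ℝ)..1, Φ (X θ) := by
  classical
  refine ⟨fun a => (volume.restrict (Set.Ioc (0 : ℝ) 1)).real {θ | X θ = a},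
    fun a => measureReal_nonneg, fun a ha => ?_, fun Φ => ?_⟩
  · by_contra! h
    apply ha
    simp only
    rw [show {θ | X θ = a} = ∅ by ext θ; simpa using h θ]
    simp
  · rw [intervalIntegral.integral_of_le zero_le_one]
    have : ∀ θ, Φ (X θ) = ∑ a, Set.indicator {θ | X θ = a} (fun _ => Φ a) θ := by
      intro θ
      rw [Finset.sum_eq_single (X θ)]
      · simp
      · intro b _ hb
        exact Set.indicator_of_notMem (by simpa using hb.symm) _
      · simp
    simp_rw [this]
    rw [integral_finsetSum]
    · refine Finset.sum_congr rfl fun a _ => ?_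
      rw [integral_indicator_const _ (hX a), smul_eq_mul]
    · intro a _
      exact (integrable_const _).indicator (hX a)

theorem intervalIntegrable_floor_add (b : ℝ) :
    IntervalIntegrable (fun θ : ℝ => ((⌊b + θ⌋ : ℤ) : ℝ)) MeasureTheory.volume 0 1 := by
  apply Monotone.intervalIntegrable
  intro x y h
  have : ⌊b + x⌋ ≤ ⌊b + y⌋ := Int.floor_le_floor (by linarith)
  simp only
  exact_mod_cast this

/-- The fractional part of `b + θ` runs through a full period, so it averages to `1 / 2`, as does
`θ`. -/
theorem integral_floor_add (b : ℝ) : ∫ θ in (0 : ℝ)..1, ((⌊b + θ⌋ : ℤ) : ℝ) = b := by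
  have h : ∀ a : ℝ, ∫ θ in (0 : ℝ)..1, Int.fract (a + θ) =
      ∫ θ in (0 : ℝ)..1, Int.fract θ := by
    intro a
    have hp : Function.Periodic (Int.fract : ℝ → ℝ) 1 := fun x => Int.fract_add_one x
    rw [intervalIntegral.integral_comp_add_left (fun x => Int.fract x) a]
    have := hp.intervalIntegral_add_eq a 0
    simpa using this
  have h2 : ∫ θ in (0 : ℝ)..1, Int.fract θ = 1 / 2 := by
    rw [show (1 / 2 : ℝ) = ∫ θ in (0 : ℝ)..1, θ by rw [integral_id]; norm_num]
    rw [intervalIntegral.integral_of_le zero_le_one, intervalIntegral.integral_of_le zero_le_one,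
      MeasureTheory.integral_Ioc_eq_integral_Ioo, MeasureTheory.integral_Ioc_eq_integral_Ioo]
    apply MeasureTheory.setIntegral_congr_fun measurableSet_Ioo
    intro x hx
    exact Int.fract_eq_self.2 ⟨hx.1.le, hx.2⟩
  have h3 : ∀ θ : ℝ, Int.fract (b + θ) = (b + θ) - ((⌊b + θ⌋ : ℤ) : ℝ) := fun θ => rfl
  have h4 := h b
  simp_rw [h3] at h4
  rw [h2, intervalIntegral.integral_sub (Continuous.intervalIntegrable (by fun_prop) _ _) (intervalIntegrable_floor_add b),
    intervalIntegral.integral_add (by simp) (by simp)] at h4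
  rw [intervalIntegral.integral_const, integral_id] at h4
  norm_num at h4
  linarith

/-- The mass of `y` on the first `j` timesteps. -/
noncomputable def cumMass {T : ℕ} (y : Fin T → ℝ) (j : ℕ) : ℝ :=
  ∑ s : Fin T with s.1 < j, y s

theorem cumMass_succ {T : ℕ} (y : Fin T → ℝ) (s : Fin T) :
    cumMass y (s + 1) = cumMass y s + y s := by
  unfold cumMass
  rw [show (Finset.univ.filter fun s' : Fin T => s'.1 < s.1 + 1) =
    insert s (Finset.univ.filter fun s' : Fin T => s'.1 < s.1) by
      ext s'; simp [Fin.ext_iff]; omega, Finset.sum_insert (by simp), add_comm]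

theorem cumMass_mono {T : ℕ} {y : Fin T → ℝ} (hy : ∀ s, 0 ≤ y s) : Monotone (cumMass y) := by
  intro a b h
  refine Finset.sum_le_sum_of_subset_of_nonneg ?_ fun s _ _ => hy s
  intro s
  simp only [Finset.mem_filter, Finset.mem_univ, true_and]
  omega

theorem cumMass_le_sum {T : ℕ} {y : Fin T → ℝ} (hy : ∀ s, 0 ≤ y s) (j : ℕ) :
    cumMass y j ≤ ∑ s, y s :=
  Finset.sum_le_sum_of_subset_of_nonneg (Finset.subset_univ _) fun s _ _ => hy s

theorem cumMass_sub {T : ℕ} (y : Fin T → ℝ) {a b : ℕ} (h : a ≤ b) :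
    cumMass y b - cumMass y a = ∑ s : Fin T with a ≤ s.1 ∧ s.1 < b, y s := by
  unfold cumMass
  rw [sub_eq_iff_eq_add, ← Finset.sum_union]
  · congr 1
    ext s
    simp only [Finset.mem_filter, Finset.mem_univ, true_and, Finset.mem_union]
    omega
  · rw [Finset.disjoint_left]
    intro s
    simp only [Finset.mem_filter, Finset.mem_univ, true_and]
    omega

/-- Systematic rounding: the timesteps at which the shifted cumulative mass passes an integer. -/
noncomputable def roundedOrders {T : ℕ} (y : Fin T → ℝ) (θ : ℝ) : Finset (Fin T) :=
  Finset.univ.filter fun s => ⌊cumMass y s + θ⌋ < ⌊cumMass y (s + 1) + θ⌋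

theorem floor_cumMass_mono {T : ℕ} {y : Fin T → ℝ} (hy0 : ∀ s, 0 ≤ y s) (θ : ℝ) :
    Monotone fun j => ⌊cumMass y j + θ⌋ := fun _ _ h =>
  Int.floor_le_floor (add_le_add_left (cumMass_mono hy0 h) θ)

/-- Each step of the cumulative mass is at most 1, so it passes at most one integer. Counts of
orders thus become telescoping differences of floors. -/
theorem indicator_roundedOrders {T : ℕ} {y : Fin T → ℝ} (hy0 : ∀ s, 0 ≤ y s)
    (hy1 : ∀ s, y s ≤ 1) (θ : ℝ) (s : Fin T) :
    (if s ∈ roundedOrders y θ then (1 : ℤ) else 0) =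
      ⌊cumMass y (s + 1) + θ⌋ - ⌊cumMass y s + θ⌋ := by
  have h1 := floor_cumMass_mono hy0 θ (Nat.le_succ s.1)
  have h2 : ⌊cumMass y (s + 1) + θ⌋ ≤ ⌊cumMass y s + θ⌋ + 1 := by
    rw [← Int.floor_add_one, cumMass_succ]
    exact Int.floor_le_floor (by linarith [hy1 s])
  simp only [Nat.succ_eq_add_one] at h1
  simp only [roundedOrders, Finset.mem_filter, Finset.mem_univ, true_and]
  split_ifs <;> omega

theorem card_roundedOrders_Ico {T : ℕ} {y : Fin T → ℝ} (hy0 : ∀ s, 0 ≤ y s)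
    (hy1 : ∀ s, y s ≤ 1) (θ : ℝ) (a : ℕ) {b : ℕ} (hab : a ≤ b) (hb : b ≤ T) :
    (((roundedOrders y θ).filter fun s => a ≤ s.1 ∧ s.1 < b).card : ℤ) =
      ⌊cumMass y b + θ⌋ - ⌊cumMass y a + θ⌋ := by
  induction b, hab using Nat.le_induction with
  | base =>
    rw [Finset.filter_false_of_mem]
    · simp
    · intro s _
      omega
  | succ b hab ih =>
    have := ih (by omega)
    have h2 := indicator_roundedOrders hy0 hy1 θ ⟨b, hb⟩
    simp only at h2
    have h3 : ((roundedOrders y θ).filter fun s => a ≤ s.1 ∧ s.1 < b + 1) =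
        ((roundedOrders y θ).filter fun s => a ≤ s.1 ∧ s.1 < b) ∪
        (if (⟨b, hb⟩ : Fin T) ∈ roundedOrders y θ then {⟨b, hb⟩} else ∅) := by
      ext s
      have : s = ⟨b, hb⟩ ↔ s.1 = b := Fin.ext_iff
      split_ifs with h
      · simp only [Finset.mem_filter, Finset.mem_union, Finset.mem_singleton]
        constructor
        · rintro ⟨h1, h2, h3⟩
          by_cases hs : s.1 = b
          · exact Or.inr (this.2 hs)
          · exact Or.inl ⟨h1, h2, by omega⟩
        · rintro (⟨h1, h2, h3⟩ | h1)
          · exact ⟨h1, h2, by omega⟩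
          · subst h1
            exact ⟨h, hab, by simp⟩
      · simp only [Finset.mem_filter, Finset.mem_union, Finset.notMem_empty, or_false]
        constructor
        · rintro ⟨h1, h2, h3⟩
          refine ⟨h1, h2, ?_⟩
          by_contra hs
          exact h (this.2 (by omega) ▸ h1)
        · rintro ⟨h1, h2, h3⟩
          exact ⟨h1, h2, by omega⟩
    rw [h3, Finset.card_union_of_disjoint]
    · split_ifs at h2 ⊢ <;> simp <;> omega
    · rw [Finset.disjoint_left]
      intro s hs
      split_ifs
      · simp only [Finset.mem_singleton]
        rintro rfl
        simp at hs
      · simp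

/-- `cumMass y t` omits timestep `t`, which adds at most 1; the floors add less than 1. -/
theorem card_roundedOrders_Icc_le {T : ℕ} {y : Fin T → ℝ} (hy0 : ∀ s, 0 ≤ y s)
    (hy1 : ∀ s, y s ≤ 1) (θ : ℝ) {s t : Fin T} (hst : s ≤ t) :
    (((roundedOrders y θ).filter fun r => s ≤ r ∧ r ≤ t).card : ℝ) ≤
      cumMass y t - cumMass y s + 2 := by
  have h := card_roundedOrders_Ico hy0 hy1 θ s.1 (b := t.1 + 1) (by
    have : s.1 ≤ t.1 := hst
    omega) t.2
  have h1 : ((roundedOrders y θ).filter fun r => s ≤ r ∧ r ≤ t) =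
      (roundedOrders y θ).filter fun r => s.1 ≤ r.1 ∧ r.1 < t.1 + 1 := by
    ext r
    simp only [Finset.mem_filter, Fin.le_def]
    refine and_congr_right fun _ => ?_
    omega
  rw [h1]
  have h2 : (((roundedOrders y θ).filter fun r => s.1 ≤ r.1 ∧ r.1 < t.1 + 1).card : ℝ) =
      (⌊cumMass y (t + 1) + θ⌋ : ℝ) - ⌊cumMass y s + θ⌋ := by exact_mod_cast h
  have h3 := Int.floor_le (cumMass y (t + 1) + θ)
  have h4 := Int.lt_floor_add_one (cumMass y s + θ)
  have h5 := cumMass_succ y t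
  linarith [hy1 t]

/-- Systematic rounding as an explicit mixture of order sets. -/
theorem exists_order_mixture {T : ℕ} {y : Fin T → ℝ} (hy0 : ∀ s, 0 ≤ y s)
    (hy1 : ∀ s, y s ≤ 1) :
    ∃ w : Finset (Fin T) → ℝ, (∀ A, 0 ≤ w A) ∧ ∑ A, w A = 1 ∧
      (∀ A, w A ≠ 0 → (∀ s ∈ A, y s ≠ 0) ∧ (∀ s, y s = 1 → s ∈ A) ∧
        ∀ s t : Fin T, s ≤ t →
          ((A.filter fun r => s ≤ r ∧ r ≤ t).card : ℝ) ≤ cumMass y t - cumMass y s + 2) ∧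
      (∀ s, ∑ A, w A * (if s ∈ A then 1 else 0) = y s) ∧
      (∀ a b : ℕ, a ≤ b → b ≤ T → min 1 (cumMass y b - cumMass y a) ≤
        ∑ A, w A * (if ∃ s ∈ A, a ≤ s.1 ∧ s.1 < b then 1 else 0)) := by
  classical
  have hmeas : ∀ j, Measurable fun θ : ℝ => ⌊cumMass y j + θ⌋ := fun j =>
    Int.measurable_floor.comp (measurable_const.add measurable_id)
  obtain ⟨w, h1, h2, h3⟩ := exists_mixture_of_uniform (roundedOrders y) (by
    intro A
    have : {θ | roundedOrders y θ = A} =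
        ⋂ s : Fin T, {θ | ⌊cumMass y s + θ⌋ < ⌊cumMass y (s + 1) + θ⌋ ↔ s ∈ A} := by
      ext θ
      simp [roundedOrders, Finset.ext_iff]
    rw [this]
    refine MeasurableSet.iInter fun s => ?_
    by_cases hs : s ∈ A
    · simp only [hs, iff_true]
      exact measurableSet_lt (hmeas _) (hmeas _)
    · simp only [hs, iff_false, not_lt]
      exact measurableSet_le (hmeas _) (hmeas _))
  refine ⟨w, h1, ?_, ?_, ?_, ?_⟩
  · simpa using h3 fun _ => 1
  · intro A hA
    obtain ⟨θ, rfl⟩ := h2 A hA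
    refine ⟨fun s hs h => ?_, fun s h => ?_, fun s t hst =>
      card_roundedOrders_Icc_le hy0 hy1 θ hst⟩
    · rw [roundedOrders, Finset.mem_filter, cumMass_succ, h] at hs
      simp at hs
    · rw [roundedOrders, Finset.mem_filter, cumMass_succ, h,
        show cumMass y s + 1 + θ = cumMass y s + θ + 1 by ring, Int.floor_add_one]
      simp
  · intro s
    rw [h3 fun A => if s ∈ A then 1 else 0]
    have : ∀ θ, (if s ∈ roundedOrders y θ then (1 : ℝ) else 0) =
        (⌊cumMass y (s + 1) + θ⌋ : ℝ) - ⌊cumMass y s + θ⌋ := fun θ => by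
      exact_mod_cast indicator_roundedOrders hy0 hy1 θ s
    simp_rw [this]
    rw [intervalIntegral.integral_sub (intervalIntegrable_floor_add _)
      (intervalIntegrable_floor_add _), integral_floor_add, integral_floor_add, cumMass_succ]
    ring
  · intro a b hab hb
    rw [h3 fun A => if ∃ s ∈ A, a ≤ s.1 ∧ s.1 < b then 1 else 0]
    have key : ∀ θ, (if ∃ s ∈ roundedOrders y θ, a ≤ s.1 ∧ s.1 < b then (1 : ℝ) else 0) =
        if 0 < ⌊cumMass y b + θ⌋ - ⌊cumMass y a + θ⌋ then 1 else 0 := by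
      intro θ
      rw [← card_roundedOrders_Ico hy0 hy1 θ a hab hb]
      refine if_congr ?_ rfl rfl
      rw [Nat.cast_pos, Finset.card_pos]
      simp [Finset.Nonempty]
    simp_rw [key]
    -- An interval of mass at most 1 contains at most one order, so the probability of an order is
    -- the expected count, the mass. For mass at least 1 an order is certain.
    rcases le_total (cumMass y b - cumMass y a) 1 with h | h
    · rw [min_eq_right h]
      have : ∀ θ, (if 0 < ⌊cumMass y b + θ⌋ - ⌊cumMass y a + θ⌋ then (1 : ℝ) else 0) =
          (⌊cumMass y b + θ⌋ : ℝ) - ⌊cumMass y a + θ⌋ := by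
        intro θ
        have e1 := floor_cumMass_mono hy0 θ hab
        have e2 : ⌊cumMass y b + θ⌋ ≤ ⌊cumMass y a + θ⌋ + 1 := by
          rw [← Int.floor_add_one]
          exact Int.floor_le_floor (by linarith)
        simp only at e1
        split_ifs with h0
        · have : ⌊cumMass y b + θ⌋ = ⌊cumMass y a + θ⌋ + 1 := by omega
          rw [this]; push_cast; ring
        · have : ⌊cumMass y b + θ⌋ = ⌊cumMass y a + θ⌋ := by omega
          rw [this]; ring
      simp_rw [this]
      rw [intervalIntegral.integral_sub (intervalIntegrable_floor_add _)
        (intervalIntegrable_floor_add _), integral_floor_add, integral_floor_add]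
    · rw [min_eq_left h]
      have : ∀ θ, (if 0 < ⌊cumMass y b + θ⌋ - ⌊cumMass y a + θ⌋ then (1 : ℝ) else 0) = 1 := by
        intro θ
        have e2 : ⌊cumMass y a + θ⌋ + 1 ≤ ⌊cumMass y b + θ⌋ := by
          rw [← Int.floor_add_one]
          exact Int.floor_le_floor (by linarith)
        rw [if_pos (by omega)]
      simp_rw [this]
      simp

/-! ### Service by the latest order -/

/-- Abel summation: moving mass from earlier to later positions cannot raise an antitone cost. -/
theorem sum_mul_nonneg_of_antitone {n : ℕ} {δ h : ℕ → ℝ}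
    (hanti : ∀ s s', s ≤ s' → s' < n → h s' ≤ h s)
    (hδ : ∀ m ≤ n, 0 ≤ ∑ s ∈ Finset.range m, δ s) (htot : ∑ s ∈ Finset.range n, δ s = 0) :
    0 ≤ ∑ s ∈ Finset.range n, δ s * h s := by
  have key : ∀ m ≤ n, ∀ c, (∀ s < m, c ≤ h s) →
      c * ∑ s ∈ Finset.range m, δ s ≤ ∑ s ∈ Finset.range m, δ s * h s := by
    intro m
    induction m with
    | zero => simp
    | succ m ih =>
      intro hm c hc
      have h1 := ih (by omega) (h m) fun s hs => hanti s m hs.le hm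
      have h2 := mul_le_mul_of_nonneg_right (hc m (Nat.lt_succ_self m)) (hδ (m + 1) hm)
      refine h2.trans ?_
      rw [Finset.sum_range_succ, Finset.sum_range_succ]
      linarith
  rcases Nat.eq_zero_or_pos n with rfl | hn
  · simp
  · have := key n le_rfl (h (n - 1)) fun s hs => hanti s (n - 1) (by omega) (by omega)
    rwa [htot, mul_zero] at this

theorem min_sub_min_le {ρ a b : ℝ} (h : b ≤ a) : min ρ a - min ρ b ≤ a - b := by
  rcases le_total ρ a with h1 | h1 <;> rcases le_total ρ b with h2 | h2 <;>
    simp [h1, h2] <;> linarith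

/-- The demand is served from random positions `lam a - 1`, latest positions first, up to the total
mass `ρ`. If the positions are stochastically later than those of `x`, this is not more
expensive than `x`. -/
theorem exists_greedy_service {α : Type*} [Fintype α] (w : α → ℝ) (hw : ∀ a, 0 ≤ w a)
    (lam : α → ℕ) (n : ℕ) (hlam : ∀ a, lam a ≤ n) (x h : ℕ → ℝ) (hx : ∀ s, 0 ≤ x s)
    (hh : ∀ s, 0 ≤ h s) (hanti : ∀ s s', s ≤ s' → s' < n → h s' ≤ h s) (ρ : ℝ) (hρ : 0 ≤ ρ)
    (hcover : ρ ≤ ∑ s ∈ Finset.range n, x s)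
    (htail : ∀ s ≤ n, min ρ (∑ s' ∈ Finset.Ico s n, x s') ≤
      ∑ a, w a * (if s < lam a then 1 else 0)) :
    ∃ φ : ℕ → ℝ, (∀ s, 0 ≤ φ s ∧ φ s ≤ 1) ∧
      ∑ a, w a * (if 0 < lam a then φ (lam a - 1) else 0) = ρ ∧
      ∑ a, w a * (if 0 < lam a then φ (lam a - 1) * h (lam a - 1) else 0) ≤
        ∑ s ∈ Finset.range n, x s * h s ∧
      ∀ s < n, φ s ≠ 0 → ∃ s' ≤ s, 0 < x s' := by
  -- `W s` and `X s` are the masses at position `s` or later, under `w` and under `x`. The value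
  -- `lam a = 0` encodes that there is no position.
  set W : ℕ → ℝ := fun s => ∑ a, w a * (if s < lam a then 1 else 0) with hW
  set X : ℕ → ℝ := fun s => ∑ s' ∈ Finset.Ico s n, x s' with hX
  have hWmono : ∀ s, W (s + 1) ≤ W s := fun s => by
    refine Finset.sum_le_sum fun a _ => mul_le_mul_of_nonneg_left ?_ (hw a)
    split_ifs <;> first | omega | norm_num
  have hWn : W n = 0 := Finset.sum_eq_zero fun a _ => by simp [hlam a]
  have hXn : X n = 0 := by simp [hX]
  have hXs : ∀ s < n, X s = x s + X (s + 1) := fun s hs => Finset.sum_eq_sum_Ico_succ_bot hs _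
  have hX0 : ρ ≤ X 0 := by
    rw [Finset.range_eq_Ico] at hcover
    exact hcover
  have hW0 : ρ ≤ W 0 := by
    have h0 : min ρ (X 0) ≤ W 0 := htail 0 (Nat.zero_le n)
    rwa [min_eq_left hX0] at h0
  have hp : ∀ s, W s - W (s + 1) = ∑ a, w a * (if lam a = s + 1 then 1 else 0) := fun s => by
    rw [hW, ← Finset.sum_sub_distrib]
    refine Finset.sum_congr rfl fun a _ => ?_
    rw [← mul_sub]
    congr 1
    split_ifs <;> first | omega | norm_num
  have hsum : ∀ ψ : ℕ → ℝ, ∑ a, w a * (if 0 < lam a then ψ (lam a - 1) else 0) =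
      ∑ s ∈ Finset.range n, ψ s * (W s - W (s + 1)) := by
    intro ψ
    simp_rw [hp, Finset.mul_sum]
    rw [Finset.sum_comm]
    refine Finset.sum_congr rfl fun a _ => ?_
    split_ifs with h0
    · rw [Finset.sum_eq_single (lam a - 1)]
      · rw [if_pos (by omega)]; ring
      · intro b _ hb
        rw [if_neg (by omega)]; ring
      · intro hb
        have := hlam a
        simp only [Finset.mem_range] at hb
        omega
    · rw [mul_zero, Finset.sum_eq_zero]
      intro s _
      rw [if_neg (by omega)]; ring
  -- The mass served at position `s` when the tail is capped at `ρ`. Dividing by the available mass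
  -- gives the probability `φ`; where that mass is zero, so is `g`.
  set g : ℕ → ℝ := fun s => min ρ (W s) - min ρ (W (s + 1)) with hg
  have hg0 : ∀ s, 0 ≤ g s := fun s => sub_nonneg.2 (min_le_min_left ρ (hWmono s))
  have hgp : ∀ s, g s ≤ W s - W (s + 1) := fun s => min_sub_min_le (hWmono s)
  have hφp : ∀ s, g s / (W s - W (s + 1)) * (W s - W (s + 1)) = g s := fun s => by
    by_cases h0 : W s - W (s + 1) = 0
    · rw [h0, mul_zero]
      have := hgp s
      rw [h0] at this
      exact le_antisymm (hg0 s) this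
    · exact div_mul_cancel₀ _ h0
  have hgsum : ∀ m, ∑ s ∈ Finset.range m, g s = min ρ (W 0) - min ρ (W m) := fun m =>
    Finset.sum_range_sub' (fun s => min ρ (W s)) m
  refine ⟨fun s => g s / (W s - W (s + 1)), fun s => ⟨div_nonneg (hg0 s)
    (sub_nonneg.2 (hWmono s)), div_le_one_of_le₀ (hgp s) (sub_nonneg.2 (hWmono s))⟩, ?_, ?_, ?_⟩
  · rw [hsum fun s => g s / (W s - W (s + 1)), Finset.sum_congr rfl fun s _ => hφp s, hgsum, hWn, min_eq_left hW0, min_eq_right hρ,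
      sub_zero]
  · rw [hsum fun s => g s / (W s - W (s + 1)) * h s]
    have h1 : ∀ s ∈ Finset.range n,
        g s / (W s - W (s + 1)) * h s * (W s - W (s + 1)) = g s * h s := fun s _ => by
      rw [mul_right_comm, hφp]
    rw [Finset.sum_congr rfl h1]
    set b : ℕ → ℝ := fun s => min ρ (X s) - min ρ (X (s + 1)) with hb
    have hbsum : ∀ m, ∑ s ∈ Finset.range m, b s = min ρ (X 0) - min ρ (X m) := fun m =>
      Finset.sum_range_sub' (fun s => min ρ (X s)) m
    -- `b` is `x` with its tail capped at `ρ`; its tails are dominated by those of `g`.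
    have h2 : 0 ≤ ∑ s ∈ Finset.range n, (b s - g s) * h s := by
      apply sum_mul_nonneg_of_antitone hanti
      · intro m hm
        rw [Finset.sum_sub_distrib, hbsum, hgsum, min_eq_left hX0, min_eq_left hW0]
        have : min ρ (X m) ≤ min ρ (W m) := le_min (min_le_left _ _) (htail m hm)
        linarith
      · rw [Finset.sum_sub_distrib, hbsum, hgsum, min_eq_left hX0, min_eq_left hW0, hXn, hWn,
          sub_self]
    simp_rw [sub_mul] at h2
    rw [Finset.sum_sub_distrib] at h2
    have h3 : ∑ s ∈ Finset.range n, b s * h s ≤ ∑ s ∈ Finset.range n, x s * h s := by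
      refine Finset.sum_le_sum fun s hs => mul_le_mul_of_nonneg_right ?_ (hh s)
      have e := hXs s (Finset.mem_range.1 hs)
      have := min_sub_min_le (ρ := ρ) (a := X s) (b := X (s + 1)) (by linarith [hx s])
      simp only [hb]
      linarith
    linarith
  · intro s hs hφ
    by_contra! hcon
    -- Without mass of `x` up to `s`, the positions after `s` already supply `ρ`, so nothing is
    -- served at `s`.
    have h1 : X (s + 1) = X 0 := by
      have : X 0 = ∑ s' ∈ Finset.Ico 0 (s + 1), x s' + X (s + 1) :=
        (Finset.sum_Ico_consecutive _ (Nat.zero_le _) hs).symm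
      rw [this, Finset.sum_eq_zero, zero_add]
      intro s' hs'
      exact le_antisymm (hcon s' (by simp at hs'; omega)) (hx s')
    have h2 : ρ ≤ W (s + 1) := by
      have := htail (s + 1) hs
      change min ρ (X (s + 1)) ≤ W (s + 1) at this
      rwa [h1, min_eq_left hX0] at this
    apply hφ
    have : g s = 0 := by
      simp only [hg]
      rw [min_eq_left h2, min_eq_left (h2.trans (hWmono s)), sub_self]
    simp only [this, zero_div]

/-- `exists_greedy_service` for the latest order of a random order set. -/
theorem exists_service_by_latest_order {T : ℕ} (w : Finset (Fin T) → ℝ) (hw : ∀ A, 0 ≤ w A)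
    (t : Fin T) (x h : Fin T → ℝ) (hx : ∀ s, 0 ≤ x s) (hh : ∀ s, 0 ≤ h s)
    (hanti : ∀ s s', s ≤ s' → s' ≤ t → h s' ≤ h s) (ρ : ℝ) (hρ : 0 ≤ ρ)
    (hcover : ρ ≤ ∑ s ∈ Finset.Iic t, x s)
    (htail : ∀ a ≤ t.1 + 1, min ρ (∑ s : Fin T with a ≤ s.1 ∧ s.1 < t.1 + 1, x s) ≤
      ∑ A, w A * (if ∃ s ∈ A, a ≤ s.1 ∧ s.1 < t.1 + 1 then 1 else 0)) :
    ∃ u e : Finset (Fin T) → ℝ, (∀ A, 0 ≤ u A) ∧ (∀ A, u A ≤ 1) ∧ (∀ A, 0 ≤ e A) ∧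
      ∑ A, w A * u A = ρ ∧ ∑ A, w A * (u A * e A) ≤ ∑ s ∈ Finset.Iic t, x s * h s ∧
      ∀ A, u A ≠ 0 → ∃ s ∈ A, s ≤ t ∧ h s = e A ∧ ∃ s' ≤ s, 0 < x s' := by
  classical
  let ext : (Fin T → ℝ) → ℕ → ℝ := fun a s => if hs : s < T then a ⟨s, hs⟩ else 0
  have hext : ∀ a, (∀ s, 0 ≤ a s) → ∀ s, 0 ≤ ext a s := fun a ha s => by
    simp only [ext]; split_ifs <;> simp [ha]
  have hextv : ∀ a (s : Fin T), ext a s = a s := fun a s => by simp [ext]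
  have hIco : ∀ (z : ℕ → ℝ) (a : ℕ), ∑ s ∈ Finset.Ico a (t.1 + 1), z s =
      ∑ s : Fin T with a ≤ s.1 ∧ s.1 < t.1 + 1, z s := by
    intro z a
    symm
    refine Finset.sum_bij (fun s _ => s.1) ?_ ?_ ?_ ?_
    · intro s hs
      simpa using hs
    · intro s _ s' _ h
      exact Fin.ext h
    · intro b hb
      have := t.2
      simp only [Finset.mem_Ico] at hb
      exact ⟨⟨b, by omega⟩, by
        simp only [Finset.mem_filter, Finset.mem_univ, true_and]
        exact hb, rfl⟩
    · intro s _
      rfl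
  have hIic : Finset.Iic t = Finset.univ.filter fun s : Fin T => 0 ≤ s.1 ∧ s.1 < t.1 + 1 := by
    ext s
    simp only [Finset.mem_Iic, Finset.mem_filter, Finset.mem_univ, true_and, Fin.le_def]
    omega
  have hrange : ∀ z : ℕ → ℝ, ∑ s ∈ Finset.range (t.1 + 1), z s = ∑ s ∈ Finset.Iic t, z s := by
    intro z
    have e := hIco z 0
    rw [← Finset.range_eq_Ico] at e
    rw [e, hIic]
  -- One more than the latest order up to `t`; the empty supremum 0 means that there is none.
  let lam : Finset (Fin T) → ℕ := fun A => (A.filter (· ≤ t)).sup fun s => s.1 + 1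
  have hlt : ∀ A a, a < lam A ↔ ∃ s ∈ A, a ≤ s.1 ∧ s.1 < t.1 + 1 := by
    intro A a
    simp only [lam, Finset.lt_sup_iff, Finset.mem_filter, Fin.le_def]
    constructor
    · rintro ⟨s, ⟨h1, h2⟩, h3⟩
      exact ⟨s, h1, by omega, by omega⟩
    · rintro ⟨s, h1, h2, h3⟩
      exact ⟨s, ⟨h1, by omega⟩, by omega⟩
  have hlamle : ∀ A, lam A ≤ t.1 + 1 := fun A => Finset.sup_le fun s hs => by
    have := (Finset.mem_filter.1 hs).2
    simp only [Fin.le_def] at this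
    omega
  have hmem : ∀ A, 0 < lam A → ∃ s ∈ A, s ≤ t ∧ s.1 = lam A - 1 := by
    intro A h0
    obtain ⟨s, h1, h2, h3⟩ := (hlt A (lam A - 1)).1 (by omega)
    refine ⟨s, h1, by rw [Fin.le_def]; omega, ?_⟩
    by_contra hne
    have := (hlt A s.1).2 ⟨s, h1, le_rfl, h3⟩
    omega
  obtain ⟨φ, h1, h2, h3, h4⟩ := exists_greedy_service w hw lam (t.1 + 1) hlamle (ext x) (ext h)
    (hext x hx) (hext h hh) (by
      intro s s' hs hs'
      have := t.2
      have e1 := hextv h ⟨s, by omega⟩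
      have e2 := hextv h ⟨s', by omega⟩
      simp only at e1 e2
      rw [e1, e2]
      exact hanti _ _ hs (by rw [Fin.le_def]; simp only; omega)) ρ hρ (by
      rw [hrange]; simpa [hextv] using hcover) (by
      intro s hs
      rw [hIco]
      simp_rw [hextv, hlt]
      exact htail s hs)
  refine ⟨fun A => if 0 < lam A then φ (lam A - 1) else 0,
    fun A => ext h (lam A - 1), fun A => ?_, fun A => ?_, fun A => hext h hh _, h2, ?_, ?_⟩
  · simp only
    split_ifs <;> simp [(h1 _).1]
  · simp only
    split_ifs <;> simp [(h1 _).2]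
  · rw [hrange] at h3
    simp_rw [hextv] at h3
    simpa only [ite_mul, zero_mul] using h3
  · intro A hA
    simp only [ne_eq, ite_eq_right_iff, Classical.not_imp] at hA
    obtain ⟨s, hs1, hs2, hs3⟩ := hmem A hA.1
    obtain ⟨s', hs', hxs'⟩ := h4 (lam A - 1) (by have := hlamle A; omega) hA.2
    refine ⟨s, hs1, hs2, ?_, ⟨s', by omega⟩, by rw [Fin.le_def]; simp only; omega, ?_⟩
    · simp only [← hs3, hextv]
    · simpa only [hextv] using (hextv x ⟨s', by have := hlamle A; omega⟩) ▸ hxs'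

/-! ### Blocks of similar mass -/

/-- The timesteps are divided into `2 ^ k` consecutive blocks of about the same mass. -/
noncomputable def timeBlock {T : ℕ} (y : Fin T → ℝ) (k : ℕ) (s : Fin T) : ℕ :=
  ⌊cumMass y s / ((∑ s, y s) / 2 ^ k + 1)⌋₊

/-- The `+ 1` in the block width makes `2 ^ k` widths strictly exceed the total mass, even when that
is zero. -/
theorem timeBlock_lt {T : ℕ} {y : Fin T → ℝ} (hy : ∀ s, 0 ≤ y s) (k : ℕ) (s : Fin T) :
    timeBlock y k s < 2 ^ k := by
  have hY : 0 ≤ ∑ s, y s := Finset.sum_nonneg fun s _ => hy s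
  have h2 : (0 : ℝ) < 2 ^ k := by positivity
  have hc : 0 ≤ cumMass y s := Finset.sum_nonneg fun s _ => hy s
  rw [timeBlock, Nat.floor_lt (by positivity)]
  push_cast
  rw [div_lt_iff₀ (by positivity), mul_add, mul_div_cancel₀ _ h2.ne']
  linarith [cumMass_le_sum hy s]

theorem timeBlock_mono {T : ℕ} {y : Fin T → ℝ} (hy : ∀ s, 0 ≤ y s) (k : ℕ) :
    Monotone (timeBlock y k) := by
  intro s t hst
  have hY : 0 ≤ ∑ s, y s := Finset.sum_nonneg fun s _ => hy s
  exact Nat.floor_mono (div_le_div_of_nonneg_right (cumMass_mono hy hst) (by positivity))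

/-- The cumulative masses at the first and last order in a block differ by less than the width,
whose `+ 1` joins the rounding error 2. -/
theorem card_filter_timeBlock_le {T : ℕ} {y : Fin T → ℝ} (hy : ∀ s, 0 ≤ y s) (k : ℕ)
    (A : Finset (Fin T)) (hA : ∀ s t : Fin T, s ≤ t →
      ((A.filter fun r => s ≤ r ∧ r ≤ t).card : ℝ) ≤ cumMass y t - cumMass y s + 2) (b : ℕ) :
    ((A.filter fun s => timeBlock y k s = b).card : ℝ) ≤ (∑ s, y s) / 2 ^ k + 3 := by
  have hY : 0 ≤ ∑ s, y s := Finset.sum_nonneg fun s _ => hy s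
  rcases (A.filter fun s => timeBlock y k s = b).eq_empty_or_nonempty with h | h
  · rw [h]
    simp only [Finset.card_empty, Nat.cast_zero]
    positivity
  · set B := A.filter fun s => timeBlock y k s = b
    have h1 := (Finset.mem_filter.1 (B.min'_mem h)).2
    have h2 := (Finset.mem_filter.1 (B.max'_mem h)).2
    have h3 := hA _ _ (B.min'_le_max' h)
    have h4 : B.card ≤ (A.filter fun r => B.min' h ≤ r ∧ r ≤ B.max' h).card := by
      refine Finset.card_le_card fun s hs => Finset.mem_filter.2
        ⟨(Finset.mem_filter.1 hs).1, B.min'_le _ hs, B.le_max' _ hs⟩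
    have h5 : (B.card : ℝ) ≤ (A.filter fun r => B.min' h ≤ r ∧ r ≤ B.max' h).card := by
      exact_mod_cast h4
    have hL : 0 < (∑ s, y s) / 2 ^ k + 1 := by positivity
    have h6 : cumMass y (B.max' h) < (b + 1) * ((∑ s, y s) / 2 ^ k + 1) := by
      rw [← div_lt_iff₀ hL, ← h2]
      exact Nat.lt_floor_add_one _
    have h7 : b * ((∑ s, y s) / 2 ^ k + 1) ≤ cumMass y (B.min' h) := by
      rw [← le_div_iff₀ hL, ← h1]
      exact Nat.floor_le (div_nonneg (Finset.sum_nonneg fun s _ => hy s) hL.le)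
    linarith

/-! ### Merging order sets across blocks -/

section Merge

variable {T : ℕ} (β : Fin T → ℕ)

/-- The orders of `A` in block `b`. -/
def blockOrders (A : Finset (Fin T)) (b : ℕ) : Finset (Fin T) :=
  A.filter fun s => β s = b

/-- The last order of `A` before block `b`, if there is one. -/
def lastBefore (A : Finset (Fin T)) (b : ℕ) : Finset (Fin T) :=
  A.filter fun s => β s < b ∧ ∀ s' ∈ A, β s' < b → s' ≤ s

/-- In each block `b`, follow all order sets in `S b`; when an order set is newly followed, place
its last earlier order, too. -/
def mergedOrders (m : ℕ) (S : ℕ → Finset (Finset (Fin T))) : Finset (Fin T) :=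
  (Finset.range m).biUnion fun b => ((S b).biUnion fun A => blockOrders β A b) ∪
    (S b \ S (b - 1)).biUnion fun A => lastBefore β A b

variable {β} {m : ℕ} {S : ℕ → Finset (Finset (Fin T))}

theorem card_lastBefore_le (A : Finset (Fin T)) (b : ℕ) : (lastBefore β A b).card ≤ 1 := by
  rw [Finset.card_le_one]
  intro s hs t ht
  simp only [lastBefore, Finset.mem_filter] at hs ht
  exact le_antisymm (ht.2.2 s hs.1 hs.2.1) (hs.2.2 t ht.1 ht.2.1)

theorem card_mergedOrders_le :
    (mergedOrders β m S).card ≤ ∑ b ∈ Finset.range m,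
      (∑ A ∈ S b, (blockOrders β A b).card + (S b \ S (b - 1)).card) := by
  refine Finset.card_biUnion_le.trans (Finset.sum_le_sum fun b _ => ?_)
  refine (Finset.card_union_le _ _).trans (add_le_add Finset.card_biUnion_le ?_)
  refine Finset.card_biUnion_le.trans ?_
  rw [Finset.card_eq_sum_ones]
  exact Finset.sum_le_sum fun A _ => card_lastBefore_le A b

theorem exists_of_mem_mergedOrders {s : Fin T} (hs : s ∈ mergedOrders β m S) :
    ∃ b < m, ∃ A ∈ S b, s ∈ A := by
  simp only [mergedOrders, Finset.mem_biUnion, Finset.mem_range, Finset.mem_union, blockOrders,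
    lastBefore, Finset.mem_filter, Finset.mem_sdiff] at hs
  obtain ⟨b, hb, ⟨A, hA, hs⟩ | ⟨A, hA, hs⟩⟩ := hs
  · exact ⟨b, hb, A, hA, hs.1⟩
  · exact ⟨b, hb, A, hA.1, hs.1⟩

theorem mem_mergedOrders_of_mem {b : ℕ} (hb : b < m) {A : Finset (Fin T)} (hA : A ∈ S b)
    {s : Fin T} (hs : s ∈ A) (hsb : β s = b) : s ∈ mergedOrders β m S := by
  simp only [mergedOrders, Finset.mem_biUnion, Finset.mem_range, Finset.mem_union, blockOrders,
    Finset.mem_filter]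
  exact ⟨b, hb, Or.inl ⟨A, hA, hs, hsb⟩⟩

/-- Go back from block `b` while `A` is followed. Either the block of `l` is reached and `l` itself
is placed, or `A` is newly followed in a later block, where its last earlier order, at or after `l`,
is placed. The alternative `β s < b` ensures that the order found does not miss a deadline in block
`b`. -/
theorem exists_mergedOrders_ge {b : ℕ} (hb : b < m) {A : Finset (Fin T)} (hA : A ∈ S b)
    {l : Fin T} (hl : l ∈ A) (hlb : β l ≤ b) :
    ∃ s ∈ mergedOrders β m S, l ≤ s ∧ (s = l ∨ β s < b) := by
  induction b with
  | zero => exact ⟨l, mem_mergedOrders_of_mem hb hA hl (by omega), le_rfl, Or.inl rfl⟩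
  | succ b ih =>
    rcases hlb.eq_or_lt with h | h
    · exact ⟨l, mem_mergedOrders_of_mem hb hA hl h, le_rfl, Or.inl rfl⟩
    by_cases hA' : A ∈ S b
    · obtain ⟨s, h1, h2, h3⟩ := ih (by omega) hA' (by omega)
      exact ⟨s, h1, h2, h3.imp_right fun h => by omega⟩
    · have hne : (A.filter fun s => β s < b + 1).Nonempty := ⟨l, Finset.mem_filter.2 ⟨hl, h⟩⟩
      have hmax := Finset.mem_filter.1 (Finset.max'_mem _ hne)
      refine ⟨_, ?_, Finset.le_max' _ l (Finset.mem_filter.2 ⟨hl, h⟩), Or.inr hmax.2⟩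
      simp only [mergedOrders, Finset.mem_biUnion, Finset.mem_range, Finset.mem_union]
      refine ⟨b + 1, hb, Or.inr ⟨A, Finset.mem_sdiff.2 ⟨hA, hA'⟩, Finset.mem_filter.2
        ⟨hmax.1, hmax.2, fun s' hs' h' => Finset.le_max' _ s' (Finset.mem_filter.2 ⟨hs', h'⟩)⟩⟩⟩

theorem exists_mergedOrders_service (hβ : Monotone β) {t : Fin T} (ht : β t < m)
    {A : Finset (Fin T)} (hA : A ∈ S (β t)) {l : Fin T} (hl : l ∈ A) (hlt : l ≤ t) :
    ∃ s ∈ mergedOrders β m S, l ≤ s ∧ s ≤ t := by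
  obtain ⟨s, h1, h2, rfl | h3⟩ := exists_mergedOrders_ge ht hA hl (hβ hlt)
  · exact ⟨s, h1, h2, hlt⟩
  · exact ⟨s, h1, h2, (hβ.reflect_lt h3).le⟩

end Merge

/-! ### Rounding all items together -/

theorem sum_mul_mem_fiber {δ X O : Type*} [Fintype X] [DecidableEq X] [Fintype O] (D : Finset δ)
    (φ : δ → X) (ψ : δ → ℕ) (m : ℕ) (hψ : ∀ d ∈ D, ψ d < m) (a : δ → O → ℝ)
    (F : X → ℕ → O → ℝ) :
    ∑ x, ∑ b ∈ Finset.range m, ∑ o, (∑ d ∈ D with (φ d, ψ d) = (x, b), a d o) * F x b o =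
      ∑ d ∈ D, ∑ o, a d o * F (φ d) (ψ d) o := by
  rw [← Finset.sum_fiberwise_of_maps_to (s := D) (t := Finset.univ ×ˢ Finset.range m)
    (g := fun d => (φ d, ψ d)) (by simpa using hψ), Finset.sum_product]
  refine Finset.sum_congr rfl fun x _ => Finset.sum_congr rfl fun b _ => ?_
  rw [Finset.sum_comm]
  refine Finset.sum_congr rfl fun o _ => ?_
  rw [Finset.sum_mul]
  refine Finset.sum_congr rfl fun d hd => ?_
  have := (Finset.mem_filter.1 hd).2
  simp only [Prod.mk.injEq] at this
  rw [this.1, this.2]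

/-- With all order sets fixed, demands that are rejected fractionally can be rounded: at most
`card κ` of them stay fractional, and these are served. -/
theorem exists_served_demands {δ κ : Type*} [DecidableEq δ] [Fintype κ] (D : Finset δ)
    (w : κ → δ → ℝ) (hw : ∀ j, ∀ d ∈ D, 0 ≤ w j d) (q : δ → ℝ) (hq0 : ∀ d ∈ D, 0 ≤ q d)
    (hq1 : ∀ d ∈ D, q d ≤ 1) (h : δ → ℝ) (hh : ∀ d ∈ D, 0 ≤ h d) (η : ℝ)
    (hη0 : 0 ≤ η) (hη : ∀ d ∈ D, h d ≤ η) :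
    ∃ V ⊆ D, (∀ d ∈ V, q d ≠ 1) ∧ (∀ d ∈ D, q d = 0 → d ∈ V) ∧
      (∀ j, ∑ d ∈ D \ V, w j d ≤ ∑ d ∈ D, w j d * q d) ∧
      ∑ d ∈ V, h d ≤ ∑ d ∈ D, (1 - q d) * h d + Fintype.card κ * η := by
  classical
  obtain ⟨F, h1, h2, h3, h4, h5, h6⟩ := exists_sparse_mixtures D
    (fun j d (b : Bool) => if b then 0 else w j d) (fun d b => if b then h d else 0)
    (fun d hd b => by split_ifs <;> simp [hh d hd]) (fun d b => if b then 1 - q d else q d)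
    (fun d hd b => by split_ifs <;> linarith [hq0 d hd, hq1 d hd])
    (fun d hd => by simp)
  simp only [Fintype.sum_bool, if_true, Bool.false_eq_true, if_false, zero_mul, zero_add,
    add_zero] at h2 h4 h5
  have h3t : ∀ d ∈ D, 1 - q d = 0 → F d true = 0 := fun d hd e => h3 d hd true (by simpa using e)
  have h3f : ∀ d ∈ D, q d = 0 → F d false = 0 := fun d hd e => h3 d hd false (by simpa using e)
  refine ⟨D.filter fun d => F d true ≠ 0, Finset.filter_subset _ _, ?_, ?_, ?_, ?_⟩
  · intro d hd hq
    obtain ⟨hd, hF⟩ := Finset.mem_filter.1 hd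
    exact hF (h3t d hd (by rw [hq, sub_self]))
  · intro d hd hq
    refine Finset.mem_filter.2 ⟨hd, ?_⟩
    have := h2 d hd
    rw [h3f d hd hq] at this
    intro e
    rw [e] at this
    norm_num at this
  · intro j
    rw [← h4 j]
    refine le_trans (b := ∑ d ∈ D \ D.filter fun d => F d true ≠ 0, w j d * F d false) ?_
      (Finset.sum_le_sum_of_subset_of_nonneg Finset.sdiff_subset fun d hd _ =>
        mul_nonneg (hw j d hd) (h1 d hd false))
    refine Finset.sum_le_sum fun d hd => ?_
    obtain ⟨hd, hF⟩ := Finset.mem_sdiff.1 hd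
    have e : F d true = 0 := by
      by_contra hne
      exact hF (Finset.mem_filter.2 ⟨hd, hne⟩)
    have := h2 d hd
    rw [e, zero_add] at this
    rw [this, mul_one]
  · have h7 : ∑ d ∈ D.filter (fun d => F d true ≠ 0), h d ≤
        ∑ d ∈ D, (h d * F d true + (mixExcess (F d) : ℝ) * η) := by
      rw [Finset.sum_filter]
      refine Finset.sum_le_sum fun d hd => ?_
      have hs := h2 d hd
      have hF := h1 d hd true
      split_ifs with ht
      · by_cases hf : F d false = 0
        · rw [hf, add_zero] at hs
          rw [hs, mul_one]
          have : 0 ≤ (mixExcess (F d) : ℝ) * η := by positivity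
          linarith
        · have : mixExcess (F d) = 1 := by
            have : mixSupport (F d) = Finset.univ := by
              ext b
              cases b <;> simp [mem_mixSupport, ht, hf]
            rw [mixExcess, this]
            simp
          rw [this]
          have := mul_nonneg (hh d hd) hF
          push_cast
          linarith [hη d hd]
      · have := mul_nonneg (hh d hd) hF
        positivity
    refine h7.trans ?_
    rw [Finset.sum_add_distrib, ← Finset.sum_mul, ← Nat.cast_sum]
    have h8 : ((∑ d ∈ D, mixExcess (F d) : ℕ) : ℝ) ≤ Fintype.card κ := by exact_mod_cast h6
    have h9 := mul_le_mul_of_nonneg_right h8 hη0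
    have h10 : ∑ d ∈ D, h d * (1 - q d) = ∑ d ∈ D, (1 - q d) * h d :=
      Finset.sum_congr rfl fun d _ => mul_comm _ _
    linarith

theorem mixSupport_subset_singleton {O : Type*} [Fintype O] {p : O → ℝ} {o : O}
    (h : ∀ a, p a ≠ 0 → a = o) : mixSupport p ⊆ {o} := fun a ha => by
  rw [Finset.mem_singleton]
  exact h a (mem_mixSupport.1 ha)

theorem min_one_sum_le {ι : Type*} (s : Finset ι) (x : ι → ℝ) (hx : ∀ i ∈ s, 0 ≤ x i) :
    min 1 (∑ i ∈ s, x i) ≤ ∑ i ∈ s, min 1 (x i) := by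
  by_cases h : ∃ i ∈ s, 1 ≤ x i
  · obtain ⟨i, hi, h1⟩ := h
    refine (min_le_left _ _).trans ?_
    refine (min_eq_left h1).ge.trans ?_
    exact Finset.single_le_sum (f := fun i => min 1 (x i))
      (fun j hj => le_min zero_le_one (hx j hj)) hi
  · push Not at h
    refine (min_le_right _ _).trans (Finset.sum_le_sum fun i hi => ?_)
    rw [min_eq_right (h i hi).le]

/-- The order costs of the blocks of an item, when all options in use are adopted. -/
theorem block_order_cost_le {O : Type*} [Fintype O] (p a : O → ℝ) (hp : ∀ o, 0 ≤ p o)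
    (hp1 : ∑ o, p o = 1) (ha : ∀ o, 0 ≤ a o) (L : ℝ)
    (hL : mixExcess p ≠ 0 → ∀ o ∈ mixSupport p, a o ≤ L) :
    ∑ o ∈ mixSupport p, a o ≤ ∑ o, a o * p o + mixExcess p * (2 * L) := by
  classical
  have hnn : 0 ≤ ∑ o, a o * p o := Finset.sum_nonneg fun o _ => mul_nonneg (ha o) (hp o)
  have hcard := card_mixSupport hp1
  by_cases he : mixExcess p = 0
  · rw [he] at hcard ⊢
    obtain ⟨o, ho⟩ := Finset.card_eq_one.1 hcard
    have hz : ∀ o' ≠ o, p o' = 0 := fun o' h => by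
      by_contra hne
      have := mem_mixSupport.2 hne
      rw [ho, Finset.mem_singleton] at this
      exact h this
    rw [Finset.sum_eq_single o (fun o' _ h => hz o' h) (by simp)] at hp1
    rw [ho, Finset.sum_singleton, Finset.sum_eq_single o (fun o' _ h => by rw [hz o' h, mul_zero])
      (by simp), hp1]
    simp
  · have h1 := Finset.sum_le_card_nsmul _ _ _ (hL he)
    rw [hcard, nsmul_eq_mul] at h1
    obtain ⟨o, ho⟩ := mixSupport_nonempty hp1
    have hL0 : 0 ≤ L := (ha o).trans (hL he o ho)
    have h2 : (1 : ℝ) ≤ mixExcess p := by exact_mod_cast Nat.one_le_iff_ne_zero.2 he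
    have h3 := mul_le_mul_of_nonneg_right h2 hL0
    push_cast at h1
    linarith

/-- The error has three sources: `C` extra block options, `5 * C * k` changes of order set, and `C`
demands that remain fractional. Items dearer than `κ` are integral, so their order sets are
deterministic and cause neither of the first two. -/
theorem exists_rounding {N T C : ℕ} (K : Fin N → ℝ) (hK : ∀ i, 0 ≤ K i)
    (y : Fin N → Fin T → ℝ) (hy0 : ∀ i s, 0 ≤ y i s) (hy1 : ∀ i s, y i s ≤ 1)
    (D : Finset (Fin N × Fin T)) (x : Fin N × Fin T → Fin T → ℝ) (hx : ∀ d ∈ D, ∀ s, 0 ≤ x d s)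
    (hxy : ∀ d ∈ D, ∀ s, min 1 (x d s) ≤ y d.1 s)
    (r : Fin N × Fin T → ℝ) (hr0 : ∀ d ∈ D, 0 ≤ r d) (hr1 : ∀ d ∈ D, r d ≤ 1)
    (hcover : ∀ d ∈ D, 1 ≤ r d + ∑ s ∈ Finset.Iic d.2, x d s)
    (h : Fin N × Fin T → Fin T → ℝ) (hh : ∀ d ∈ D, ∀ s, 0 ≤ h d s)
    (hanti : ∀ d ∈ D, ∀ s s', s ≤ s' → s' ≤ d.2 → h d s' ≤ h d s)
    (wt : Fin C → Fin N × Fin T → ℝ) (hwt : ∀ c d, 0 ≤ wt c d)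
    (κ : ℝ) (hκ : 0 ≤ κ) (hKκ : ∀ i, K i ≤ κ ∨ ∀ s, y i s = 0 ∨ y i s = 1)
    (η : ℝ) (hη0 : 0 ≤ η) (hη : ∀ d ∈ D, ∀ s, h d s ≤ η) (k : ℕ) :
    ∃ (S : Fin N → Finset (Fin T)) (V : Finset (Fin N × Fin T)) (τ : Fin N × Fin T → Fin T),
      (∀ i, ∀ s ∈ S i, y i s ≠ 0) ∧ (∀ i s, y i s = 1 → s ∈ S i) ∧ V ⊆ D ∧
      (∀ d ∈ V, τ d ∈ S d.1 ∧ τ d ≤ d.2 ∧ ∃ s ≤ τ d, 0 < x d s) ∧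
      (∀ d ∈ D, r d = 0 → d ∈ V) ∧
      (∀ c, ∑ d ∈ D \ V, wt c d ≤ ∑ d ∈ D, wt c d * r d) ∧
      ∑ i, K i * (S i).card + ∑ d ∈ V, h d (τ d) ≤
        ∑ i, K i * ∑ s, y i s + ∑ d ∈ D, ∑ s ∈ Finset.Iic d.2, x d s * h d s +
        (C * (2 * ((∑ i, K i * ∑ s, y i s) / 2 ^ k + 3 * κ)) + 5 * C * k * κ + C * η) := by
  classical
  choose w hw0 hw1 hwS hwmarg hwtail using fun i => exists_order_mixture (hy0 i) (hy1 i)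
  have hserve : ∀ d ∈ D, ∃ u e : Finset (Fin T) → ℝ, (∀ A, 0 ≤ u A) ∧ (∀ A, u A ≤ 1) ∧
      (∀ A, 0 ≤ e A) ∧ ∑ A, w d.1 A * u A = 1 - r d ∧
      ∑ A, w d.1 A * (u A * e A) ≤ ∑ s ∈ Finset.Iic d.2, x d s * h d s ∧
      ∀ A, u A ≠ 0 → ∃ s ∈ A, s ≤ d.2 ∧ h d s = e A ∧ ∃ s' ≤ s, 0 < x d s' := by
    intro d hd
    refine exists_service_by_latest_order (w d.1) (hw0 d.1) d.2 (x d) (h d) (hx d hd) (hh d hd)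
      (hanti d hd) (1 - r d) (by linarith [hr1 d hd]) (by linarith [hcover d hd]) ?_
    intro a ha
    refine le_trans ?_ (hwtail d.1 a (d.2.1 + 1) ha d.2.2)
    rw [cumMass_sub _ ha]
    refine le_min ((min_le_left _ _).trans (by linarith [hr0 d hd])) ?_
    refine (min_le_min_right _ (show 1 - r d ≤ 1 by linarith [hr0 d hd])).trans ?_
    exact (min_one_sum_le _ _ fun s _ => hx d hd s).trans
      (Finset.sum_le_sum fun s _ => hxy d hd s)
  choose! u e hu0 hu1 he0 huw hucost hus using hserve
  set β : Fin N → Fin T → ℕ := fun i => timeBlock (y i) k with hβ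
  have hβlt : ∀ i s, β i s < 2 ^ k := fun i s => timeBlock_lt (hy0 i) k s
  -- A demand belongs to the block of its deadline, whose mixture decides its service; orders are
  -- charged to their own block.
  obtain ⟨f, hf0, hf1, hfw, hfv, hfc, hfex, hfsw⟩ := exists_dyadic_mixtures w hw0 hw1 k
    (fun (c : Fin C) i b A => ∑ d ∈ D with (d.1, β d.1 d.2) = (i, b), wt c d * (1 - u d A))
    (fun i b A => K i * (blockOrders (β i) A b).card +
      ∑ d ∈ D with (d.1, β d.1 d.2) = (i, b), u d A * e d A) (by
      intro i b A
      refine add_nonneg (mul_nonneg (hK i) (Nat.cast_nonneg _)) (Finset.sum_nonneg fun d hd => ?_)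
      exact mul_nonneg (hu0 d (Finset.mem_filter.1 hd).1 A) (he0 d (Finset.mem_filter.1 hd).1 A))
  have hfib : ∀ (a : Fin N × Fin T → Finset (Fin T) → ℝ) (F : Fin N → ℕ → Finset (Fin T) → ℝ),
      ∑ i, ∑ b ∈ Finset.range (2 ^ k), ∑ A,
        (∑ d ∈ D with (d.1, β d.1 d.2) = (i, b), a d A) * F i b A =
      ∑ d ∈ D, ∑ A, a d A * F d.1 (β d.1 d.2) A := fun a F =>
    sum_mul_mem_fiber D (fun d => d.1) (fun d => β d.1 d.2) _ (fun d _ => hβlt _ _) a F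
  let fd : Fin N × Fin T → Finset (Fin T) → ℝ := fun d => f d.1 (β d.1 d.2)
  have hfd0 : ∀ d A, 0 ≤ fd d A := fun d A => hf0 _ _ (hβlt _ _) A
  have hfd1 : ∀ d, ∑ A, fd d A = 1 := fun d => hf1 _ _ (hβlt _ _)
  let q : Fin N × Fin T → ℝ := fun d => ∑ A, (1 - u d A) * fd d A
  have hq : ∀ d, 1 - q d = ∑ A, u d A * fd d A := fun d => by
    simp only [q, sub_mul, one_mul, Finset.sum_sub_distrib, hfd1]
    ring
  have hq0 : ∀ d ∈ D, 0 ≤ q d := fun d hd => Finset.sum_nonneg fun A _ =>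
    mul_nonneg (by linarith [hu1 d hd A]) (hfd0 d A)
  have hq1 : ∀ d ∈ D, q d ≤ 1 := fun d hd => by
    have : 0 ≤ 1 - q d := by
      rw [hq]
      exact Finset.sum_nonneg fun A _ => mul_nonneg (hu0 d hd A) (hfd0 d A)
    linarith
  have hqr : ∀ c, ∑ d ∈ D, wt c d * q d = ∑ d ∈ D, wt c d * r d := by
    intro c
    have h1 := hfv c
    rw [hfib (fun d A => wt c d * (1 - u d A)) f,
      hfib (fun d A => wt c d * (1 - u d A)) (fun i _ A => w i A)] at h1
    have h2 : ∀ d ∈ D, ∑ A, wt c d * (1 - u d A) * f d.1 (β d.1 d.2) A = wt c d * q d := by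
      intro d _
      rw [Finset.mul_sum]
      exact Finset.sum_congr rfl fun A _ => mul_assoc _ _ _
    have h3 : ∀ d ∈ D, ∑ A, wt c d * (1 - u d A) * w d.1 A = wt c d * r d := by
      intro d hd
      have : ∑ A, (1 - u d A) * w d.1 A = r d := by
        simp only [sub_mul, one_mul, Finset.sum_sub_distrib, hw1]
        simp_rw [mul_comm (u d _)]
        rw [huw d hd]
        ring
      rw [← this, Finset.mul_sum]
      exact Finset.sum_congr rfl fun A _ => mul_assoc _ _ _
    rwa [Finset.sum_congr rfl h2, Finset.sum_congr rfl h3] at h1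
  have hqzero : ∀ d ∈ D, r d = 0 → q d = 0 := by
    intro d hd hr
    have h1 : ∑ A, w d.1 A * (1 - u d A) = 0 := by
      simp only [mul_sub, mul_one, Finset.sum_sub_distrib, hw1]
      rw [huw d hd, hr]
      ring
    rw [Finset.sum_eq_zero_iff_of_nonneg fun A _ =>
      mul_nonneg (hw0 _ A) (by linarith [hu1 d hd A])] at h1
    refine Finset.sum_eq_zero fun A hA => ?_
    rcases mul_eq_zero.1 (h1 A hA) with h2 | h2
    · rw [show fd d A = 0 from hfw _ _ (hβlt _ _) A h2, mul_zero]
    · rw [h2, zero_mul]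
  let S : Fin N → Finset (Fin T) := fun i =>
    mergedOrders (β i) (2 ^ k) fun b => mixSupport (f i b)
  have hτ : ∀ d, ∃ τ, d ∈ D → q d ≠ 1 → τ ∈ S d.1 ∧ τ ≤ d.2 ∧ (∃ s ≤ τ, 0 < x d s) ∧
      (1 - q d) * h d τ ≤ ∑ A, u d A * e d A * fd d A := by
    intro d
    by_cases hd : d ∈ D
    swap
    · exact ⟨d.2, fun hd' => absurd hd' hd⟩
    by_cases hqd : q d = 1
    · exact ⟨d.2, fun _ h => absurd hqd h⟩
    have hne : (Finset.univ.filter fun A => u d A * fd d A ≠ 0).Nonempty := by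
      by_contra hcon
      rw [Finset.not_nonempty_iff_eq_empty, Finset.filter_eq_empty_iff] at hcon
      have := hq d
      rw [Finset.sum_eq_zero fun A hA => not_not.1 (hcon hA)] at this
      exact hqd (by linarith)
    -- Among the order sets in use that serve `d`, the cheapest costs no more than their average.
    -- The merged orders serve `d` no earlier than it does, hence no more expensively.
    obtain ⟨A, hA, hmin⟩ := Finset.exists_min_image _ (e d) hne
    have hA := (Finset.mem_filter.1 hA).2
    obtain ⟨l, hl, hlt, hle, s', hs', hxs'⟩ := hus d hd A (left_ne_zero_of_mul hA)
    obtain ⟨τ, h1, h2, h3⟩ := exists_mergedOrders_service (timeBlock_mono (hy0 d.1) k)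
      (t := d.2) (hβlt d.1 d.2) (S := fun b => mixSupport (f d.1 b))
      (mem_mixSupport.2 (right_ne_zero_of_mul hA)) hl hlt
    refine ⟨τ, fun _ _ => ⟨h1, h3, ⟨s', hs'.trans h2, hxs'⟩, ?_⟩⟩
    rw [hq, Finset.sum_mul]
    refine Finset.sum_le_sum fun B _ => ?_
    have hnn := mul_nonneg (hu0 d hd B) (hfd0 d B)
    rw [mul_right_comm (u d B) (e d B)]
    by_cases hB : u d B * fd d B = 0
    · rw [hB, zero_mul, zero_mul]
    · refine mul_le_mul_of_nonneg_left ?_ hnn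
      refine (hanti d hd l τ h2 h3).trans (hle.le.trans (hmin B ?_))
      exact Finset.mem_filter.2 ⟨Finset.mem_univ _, hB⟩
  choose τ hτ using hτ
  obtain ⟨V, hVD, hVq, hV0, hVw, hVc⟩ := exists_served_demands D wt (fun c d _ => hwt c d) q hq0 hq1
    (fun d => if q d ≠ 1 then h d (τ d) else 0)
    (fun d hd => by split_ifs <;> simp [hh d hd]) η hη0
    (fun d hd => by split_ifs <;> simp [hη d hd, hη0])
  rw [Fintype.card_fin] at hVc hfex hfsw
  refine ⟨S, V, τ, ?_, ?_, hVD, fun d hd => ?_, fun d hd hr => hV0 d hd (hqzero d hd hr), fun c => (hqr c) ▸ hVw c,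
    ?_⟩
  · intro i s hs
    obtain ⟨b, hb, A, hA, hsA⟩ := exists_of_mem_mergedOrders hs
    exact (hwS i A fun h0 => mem_mixSupport.1 hA (hfw i b hb A h0)).1 s hsA
  · intro i s hs
    obtain ⟨A, hA⟩ := mixSupport_nonempty (hf1 i (β i s) (hβlt i s))
    have hwA : w i A ≠ 0 := fun h0 => mem_mixSupport.1 hA (hfw i _ (hβlt i s) A h0)
    exact mem_mergedOrders_of_mem (S := fun b => mixSupport (f i b)) (hβlt i s) hA
      ((hwS i A hwA).2.1 s hs) rfl
  · obtain ⟨h1, h2, h3, -⟩ := hτ d (hVD hd) (hVq d hd)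
    exact ⟨h1, h2, h3⟩
  set OC := ∑ i, K i * ∑ s, y i s with hOC
  have hOCi : ∀ i, K i * ∑ s, y i s ≤ OC := fun i =>
    Finset.single_le_sum (f := fun i => K i * ∑ s, y i s)
      (fun i _ => mul_nonneg (hK i) (Finset.sum_nonneg fun s _ => hy0 i s)) (Finset.mem_univ i)
  have hhold : ∑ d ∈ V, h d (τ d) ≤ ∑ d ∈ D, ∑ A, u d A * e d A * fd d A + C * η := by
    have h1 : ∑ d ∈ V, h d (τ d) = ∑ d ∈ V, if q d ≠ 1 then h d (τ d) else 0 :=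
      Finset.sum_congr rfl fun d hd => by rw [if_pos (hVq d hd)]
    rw [h1]
    refine hVc.trans (add_le_add_left (Finset.sum_le_sum fun d hd => ?_) _)
    split_ifs with h0
    · exact (hτ d hd h0).2.2.2
    · rw [mul_zero]
      exact Finset.sum_nonneg fun A _ =>
        mul_nonneg (mul_nonneg (hu0 d hd A) (he0 d hd A)) (hfd0 d A)
  have hsingle : ∀ i, ¬ K i ≤ κ → ∃ A, ∀ b < 2 ^ k, mixSupport (f i b) = {A} := by
    intro i hi
    have hint := (hKκ i).resolve_left hi
    refine ⟨Finset.univ.filter fun s => y i s = 1, fun b hb => ?_⟩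
    refine (Finset.Nonempty.subset_singleton_iff (mixSupport_nonempty (hf1 i b hb))).1 ?_
    refine mixSupport_subset_singleton fun A hA => ?_
    obtain ⟨h1, h2, -⟩ := hwS i A fun h0 => hA (hfw i b hb A h0)
    ext s
    simp only [Finset.mem_filter, Finset.mem_univ, true_and]
    exact ⟨fun hs => (hint s).resolve_left (h1 s hs), h2 s⟩
  have horder : ∀ i, K i * (S i).card ≤ ∑ b ∈ Finset.range (2 ^ k),
      (∑ A, K i * (blockOrders (β i) A b).card * f i b A +
        mixExcess (f i b) * (2 * (OC / 2 ^ k + 3 * κ)) +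
        (mixSupport (f i b) \ mixSupport (f i (b - 1))).card * κ) := by
    intro i
    have h1 : ((S i).card : ℝ) ≤ ((∑ b ∈ Finset.range (2 ^ k),
      (∑ A ∈ mixSupport (f i b), (blockOrders (β i) A b).card +
        (mixSupport (f i b) \ mixSupport (f i (b - 1))).card) : ℕ) : ℝ) := by
      exact_mod_cast card_mergedOrders_le
    refine (mul_le_mul_of_nonneg_left h1 (hK i)).trans ?_
    push_cast
    rw [Finset.mul_sum]
    refine Finset.sum_le_sum fun b hb => ?_
    rw [Finset.mem_range] at hb
    rw [mul_add, Finset.mul_sum]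
    refine add_le_add ?_ ?_
    · refine block_order_cost_le (f i b) (fun A => K i * (blockOrders (β i) A b).card)
        (hf0 i b hb) (hf1 i b hb) (fun A => mul_nonneg (hK i) (Nat.cast_nonneg _)) _ ?_
      intro hex A hA
      have hKi : K i ≤ κ := by
        by_contra hcon
        obtain ⟨B, hB⟩ := hsingle i hcon
        exact hex (by rw [mixExcess, hB b hb, Finset.card_singleton])
      have h2 := card_filter_timeBlock_le (hy0 i) k A
        (hwS i A fun h0 => mem_mixSupport.1 hA (hfw i b hb A h0)).2.2 b
      refine (mul_le_mul_of_nonneg_left h2 (hK i)).trans ?_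
      rw [mul_add, ← mul_div_assoc]
      have h3 : K i * (∑ s, y i s) / 2 ^ k ≤ OC / 2 ^ k :=
        div_le_div_of_nonneg_right (hOCi i) (by positivity)
      linarith
    · rw [mul_comm]
      by_cases hKi : K i ≤ κ
      · exact mul_le_mul_of_nonneg_left hKi (Nat.cast_nonneg _)
      · obtain ⟨B, hB⟩ := hsingle i hKi
        rw [hB b hb, hB (b - 1) (by omega)]
        simp
  have hmargin : ∀ i, ∑ b ∈ Finset.range (2 ^ k),
      ∑ A, K i * (blockOrders (β i) A b).card * w i A = K i * ∑ s, y i s := by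
    intro i
    rw [Finset.sum_comm]
    have h1 : ∀ A : Finset (Fin T), ∑ b ∈ Finset.range (2 ^ k), (blockOrders (β i) A b).card =
        A.card := fun A =>
      (Finset.card_eq_sum_card_fiberwise fun s _ => by simpa using hβlt i s).symm
    have h2 : ∀ A, ∑ b ∈ Finset.range (2 ^ k), K i * (blockOrders (β i) A b).card * w i A =
        K i * ∑ s, w i A * (if s ∈ A then 1 else 0) := by
      intro A
      rw [← Finset.sum_mul, ← Finset.mul_sum, ← Nat.cast_sum, h1, ← Finset.mul_sum]
      simp
      ring
    rw [Finset.sum_congr rfl fun A _ => h2 A, ← Finset.mul_sum, Finset.sum_comm]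
    rw [Finset.sum_congr rfl fun s _ => hwmarg i s]
  have hcostsplit : ∀ F : Fin N → ℕ → Finset (Fin T) → ℝ,
      ∑ i, ∑ b ∈ Finset.range (2 ^ k), ∑ A, (K i * (blockOrders (β i) A b).card +
        ∑ d ∈ D with (d.1, β d.1 d.2) = (i, b), u d A * e d A) * F i b A =
      ∑ i, ∑ b ∈ Finset.range (2 ^ k), ∑ A, K i * (blockOrders (β i) A b).card * F i b A +
        ∑ d ∈ D, ∑ A, u d A * e d A * F d.1 (β d.1 d.2) A := by
    intro F
    rw [← hfib (fun d A => u d A * e d A) F]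
    simp only [add_mul, Finset.sum_add_distrib]
  rw [hcostsplit f, hcostsplit fun i _ A => w i A, Finset.sum_congr rfl fun i _ => hmargin i]
    at hfc
  have hserved : ∑ d ∈ D, ∑ A, u d A * e d A * w d.1 A ≤
      ∑ d ∈ D, ∑ s ∈ Finset.Iic d.2, x d s * h d s := by
    refine Finset.sum_le_sum fun d hd => le_trans (le_of_eq ?_) (hucost d hd)
    exact Finset.sum_congr rfl fun A _ => mul_comm _ _
  have hOC0 : 0 ≤ OC := Finset.sum_nonneg fun i _ =>
    mul_nonneg (hK i) (Finset.sum_nonneg fun s _ => hy0 i s)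
  have hsumorder := Finset.sum_le_sum fun i (_ : i ∈ Finset.univ) => horder i
  simp only [Finset.sum_add_distrib, ← Finset.sum_mul] at hsumorder
  have hex' : (∑ i, ∑ b ∈ Finset.range (2 ^ k), (mixExcess (f i b) : ℝ)) ≤ C := by
    exact_mod_cast hfex
  have hsw' : (∑ i, ∑ b ∈ Finset.range (2 ^ k),
      ((mixSupport (f i b) \ mixSupport (f i (b - 1))).card : ℝ)) ≤ 5 * C * k := by
    have e1 : (5 * C * k : ℝ) = ((5 * C * k : ℕ) : ℝ) := by push_cast; ring
    rw [e1]
    simp only [← Nat.cast_sum]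
    refine Nat.cast_le.2 (le_trans (le_of_eq ?_) hfsw)
    congr!
  have hL0 : 0 ≤ 2 * (OC / 2 ^ k + 3 * κ) := by positivity
  have h1 := mul_le_mul_of_nonneg_right hex' hL0
  have h2 := mul_le_mul_of_nonneg_right hsw' hκ
  simp only [fd] at hhold
  linarith

/-! ### The augmented LP and the choice of constants -/

namespace CJRP

variable {N T C : ℕ}

/-- Guessed demands are served as guessed, and the others with `1 ≤ z.r d` are rejected; only `D'`
is rounded. The real cost `h` is left free, since holding costs may be infinite. Service at or after
a time with `0 < z.x d s` preserves the ban on expensive services. -/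
theorem exists_augFeasible_integral (I : CJRP N T C) (hp : ∀ d ∈ I.D, I.p d = 0)
    (G : SideInfo N T) (hGD : G.demands ⊆ I.D) (z : CJRPVars N T) (hz : I.AugFeasible G z)
    (e₀ : Fin N × Fin T) (he₀ : e₀ ∈ G.orders) (h : Fin N × Fin T → Fin T → ℝ)
    (hh : ∀ d ∈ I.D, ∀ s, 0 ≤ h d s)
    (hanti : ∀ d ∈ I.D, ∀ s s', s ≤ s' → s' ≤ d.2 → h d s' ≤ h d s)
    (η : ℝ) (hη0 : 0 ≤ η) (hη : ∀ d ∈ I.D, ∀ s, h d s ≤ η) (k : ℕ) :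
    ∃ (z' : CJRPVars N T) (a : ℝ) (D' V : Finset (Fin N × Fin T)) (τ : Fin N × Fin T → Fin T),
      I.AugFeasible G z' ∧ z'.IsIntegral I.D ∧
      (∀ d ∈ I.D, (z.r d = 0 → z'.r d = 0) ∧ (z.r d = 1 → z'.r d = 1)) ∧ 0 ≤ a ∧
      D' ⊆ I.D ∧ Disjoint D' G.demands ∧ V ⊆ D' ∧
      (∀ d ∈ V, τ d ≤ d.2 ∧ ∃ s ≤ τ d, 0 < z.x d s) ∧
      I.cost z' = ENNReal.ofReal a + ∑ d ∈ G.demands, I.H d (G.time d) + ∑ d ∈ V, I.H d (τ d) ∧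
      a + ∑ d ∈ V, h d (τ d) ≤
        ∑ i, (I.K i : ℝ) * ∑ s, min (z.y i s) 1 +
          ∑ d ∈ D', ∑ s ∈ Finset.Iic d.2, z.x d s * h d s +
        (C * (2 * ((∑ i, (I.K i : ℝ) * ∑ s, min (z.y i s) 1) / 2 ^ k + 3 * I.K e₀.1)) +
          5 * C * k * I.K e₀.1 + C * η) := by
  classical
  have hf := hz.feasible
  set D' := I.D.filter fun d => d ∉ G.demands ∧ z.r d < 1 with hD'
  have hD'D : D' ⊆ I.D := Finset.filter_subset _ _
  obtain ⟨S, V, τ, hS0, hS1, hVD, hV, hV0, hVw, hcost⟩ := exists_rounding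
    (fun i => (I.K i : ℝ)) (fun i => (I.K i).coe_nonneg) (fun i s => min (z.y i s) 1)
    (fun i s => le_min (hf.y_nonneg i s) zero_le_one) (fun i s => min_le_right _ _) D' z.x
    (fun d hd => hf.x_nonneg d (hD'D hd))
    (fun d hd s => by
      rw [min_comm]
      exact min_le_min_right _ (hf.item_order d (hD'D hd) s)) z.r
    (fun d hd => hf.r_nonneg d (hD'D hd)) (fun d hd => (Finset.mem_filter.1 hd).2.2.le)
    (fun d hd => hf.cover d (hD'D hd)) h (fun d hd => hh d (hD'D hd))
    (fun d hd => hanti d (hD'D hd)) (fun c d => (I.w c d : ℝ)) (fun c d => (I.w c d).coe_nonneg)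
    (I.K e₀.1) (I.K e₀.1).coe_nonneg (by
      intro i
      by_cases hK : I.K i ≤ I.K e₀.1
      · exact Or.inl (by exact_mod_cast hK)
      · refine Or.inr fun s => ?_
        by_cases hs : (i, s) ∈ G.orders
        · right
          rw [hz.order_one _ hs, min_self]
        · left
          rw [hz.order_zero i s hs ⟨e₀, he₀, not_le.1 hK⟩]
          exact min_eq_left zero_le_one) η hη0 (fun d hd => hη d (hD'D hd)) k
  have htime : ∀ d ∈ G.demands, G.time d ≤ d.2 := fun d hd => by
    by_contra hcon
    have := hf.deadline d (hGD hd) _ (not_le.1 hcon)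
    rw [hz.serve_one d hd] at this
    exact one_ne_zero this
  have hVG : ∀ d ∈ V, d ∉ G.demands := fun d hd => (Finset.mem_filter.1 (hVD hd)).2.1
  let σ : Fin N × Fin T → Fin T := fun d => if d ∈ G.demands then G.time d else τ d
  have hσle : ∀ d ∈ G.demands ∪ V, σ d ≤ d.2 := fun d hd => by
    by_cases hdG : d ∈ G.demands
    · simp only [σ, hdG, if_true]
      exact htime d hdG
    · simp only [σ, hdG, if_false]
      exact (hV d ((Finset.mem_union.1 hd).resolve_left hdG)).2.1
  have hσS : ∀ d ∈ G.demands ∪ V, σ d ∈ S d.1 := fun d hd => by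
    by_cases hdG : d ∈ G.demands
    · simp only [σ, hdG, if_true]
      refine hS1 _ _ (min_eq_right ?_)
      rw [← hz.serve_one d hdG]
      exact hf.item_order d (hGD hdG) _
    · simp only [σ, hdG, if_false]
      exact (hV d ((Finset.mem_union.1 hd).resolve_left hdG)).1
  -- A guessed demand with `z.r d = 1` is both served and marked as rejected, which keeps the
  -- prescribed value of `r`.
  let z' : CJRPVars N T :=
    { y := fun i s => if s ∈ S i then 1 else 0
      x := fun d s => if d ∈ G.demands ∪ V ∧ s = σ d then 1 else 0
      r := fun d => if d ∈ G.demands then (if z.r d = 1 then 1 else 0) else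
        if d ∈ V then 0 else 1 }
  have hsum : ∀ d ∈ G.demands ∪ V, ∑ s ∈ Finset.Iic d.2, z'.x d s = 1 := by
    intro d hd
    simp only [z', hd, true_and]
    rw [Finset.sum_ite_eq', if_pos (Finset.mem_Iic.2 (hσle d hd))]
  have hxz : ∀ d s, 0 ≤ z'.x d s := fun d s => by
    simp only [z']; split_ifs <;> norm_num
  have hrz : ∀ d, 0 ≤ z'.r d := fun d => by
    simp only [z']; split_ifs <;> norm_num
  have hnotD' : ∀ d ∈ I.D, d ∉ D' → d ∉ G.demands → 1 ≤ z.r d := fun d hd hd' hdG => by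
    by_contra hcon
    exact hd' (Finset.mem_filter.2 ⟨hd, hdG, not_le.1 hcon⟩)
  have hfeas : I.Feasible z' := by
    refine ⟨fun i s => by simp only [z']; split_ifs <;> norm_num, fun d _ => hxz d,
      fun d _ => hrz d, ?_, ?_, ?_, ?_⟩
    · intro d _ s hs
      simp only [z']
      rw [if_neg]
      rintro ⟨hd, rfl⟩
      exact absurd (hσle d hd) (not_le.2 hs)
    · intro d _
      by_cases hd : d ∈ G.demands ∪ V
      · rw [hsum d hd]
        linarith [hrz d]
      · have h1 : z'.r d = 1 := by
          rw [Finset.mem_union, not_or] at hd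
          simp [z', hd.1, hd.2]
        rw [h1]
        linarith [Finset.sum_nonneg fun s (_ : s ∈ Finset.Iic d.2) => hxz d s]
    · intro d _ s
      simp only [z']
      split_ifs with h1 h2 h2 <;> try norm_num
      exact h2 (h1.2 ▸ hσS d h1.1)
    · intro c
      refine le_trans ?_ (hf.reject c)
      rw [← Finset.sum_sdiff hD'D, ← Finset.sum_sdiff hD'D]
      refine add_le_add (Finset.sum_le_sum fun d hd => ?_) (le_trans (le_of_eq ?_) (hVw c))
      · refine mul_le_mul_of_nonneg_left ?_ (I.w c d).coe_nonneg
        obtain ⟨hd, hd'⟩ := Finset.mem_sdiff.1 hd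
        have hr0 := hf.r_nonneg d hd
        simp only [z']
        split_ifs with h1 h2 h3
        · exact h2.ge
        · exact hr0
        · exact hr0
        · exact hnotD' d hd hd' h1
      · rw [← Finset.sum_sdiff hVD, add_eq_left.2 (Finset.sum_eq_zero fun d hd => by
          simp [z', hd, hVG d hd])]
        refine Finset.sum_congr rfl fun d hd => ?_
        obtain ⟨hd, hdV⟩ := Finset.mem_sdiff.1 hd
        simp [z', hdV, (Finset.mem_filter.1 hd).2.1]
  refine ⟨z', ∑ i, (I.K i : ℝ) * (S i).card, D', V, τ, ⟨hfeas, ?_, ?_, ?_, ?_⟩, ⟨?_, ?_, ?_⟩, ?_,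
    Finset.sum_nonneg fun i _ => by positivity, hD'D, ?_, hVD, fun d hd => (hV d hd).2, ?_, hcost⟩
  · intro e he
    have : e.2 ∈ S e.1 := hS1 _ _ (by rw [hz.order_one e he, min_self])
    simp [z', this]
  · intro i s his hK
    have : s ∉ S i := fun hs => hS0 i s hs (by
      rw [hz.order_zero i s his hK]
      exact min_eq_left zero_le_one)
    simp [z', this]
  · intro d hd
    simp [z', σ, hd]
  · intro d hd hdG s hs ⟨d', hd', hlt⟩
    simp only [z']
    rw [if_neg]
    rintro ⟨hdV, rfl⟩
    have hdV := (Finset.mem_union.1 hdV).resolve_left hdG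
    obtain ⟨-, h2, s', hs', hx⟩ := hV d hdV
    simp only [σ, hdG, if_false] at hlt
    have h3 := hz.serve_zero d hd hdG s' (hs'.trans h2)
      ⟨d', hd', hlt.trans_le (I.H_antitone d hd s' _ hs' h2)⟩
    exact hx.ne' h3
  · intro i s
    simp only [z']
    split_ifs <;> simp
  · intro d _ s
    simp only [z']
    split_ifs <;> simp
  · intro d _
    simp only [z']
    split_ifs <;> simp
  · intro d hd
    constructor
    · intro hr
      simp only [z']
      split_ifs with h1 h2 h3
      · rw [hr] at h2
        exact absurd h2 zero_ne_one
      · rfl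
      · rfl
      · exact absurd (hV0 d (Finset.mem_filter.2 ⟨hd, h1, by rw [hr]; exact zero_lt_one⟩) hr) h3
    · intro hr
      simp only [z']
      split_ifs with h1 h2
      · rfl
      · have := (Finset.mem_filter.1 (hVD h2)).2.2
        rw [hr] at this
        exact absurd this (lt_irrefl _)
      · rfl
  · rw [Finset.disjoint_left]
    exact fun d hd => (Finset.mem_filter.1 hd).2.1
  · unfold cost
    rw [Finset.sum_eq_zero (f := fun d => (I.p d : ℝ≥0∞) * _) fun d hd => by simp [hp d hd],
      add_zero, add_assoc]
    congr 1
    · rw [ENNReal.ofReal_sum_of_nonneg fun i _ => by positivity]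
      refine Finset.sum_congr rfl fun i _ => ?_
      rw [ENNReal.ofReal_mul (I.K i).coe_nonneg, ENNReal.ofReal_coe_nnreal, ENNReal.ofReal_natCast,
        ← Finset.mul_sum]
      congr 1
      have : ∀ s, ENNReal.ofReal (z'.y i s) = if s ∈ S i then 1 else 0 := fun s => by
        simp only [z']
        split_ifs <;> simp
      simp only [this]
      simp
    · have h1 : ∀ d ∈ I.D, ∑ s ∈ Finset.Iic d.2, I.H d s * ENNReal.ofReal (z'.x d s) =
          if d ∈ G.demands ∪ V then I.H d (σ d) else 0 := by
        intro d _
        split_ifs with hd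
        · rw [Finset.sum_eq_single (σ d)]
          · simp [z', hd]
          · intro s _ hs
            simp [z', hs]
          · exact fun hn => absurd (Finset.mem_Iic.2 (hσle d hd)) hn
        · exact Finset.sum_eq_zero fun s _ => by simp [z', hd]
      rw [Finset.sum_congr rfl h1, ← Finset.sum_filter, Finset.filter_mem_eq_inter,
        Finset.inter_eq_right.2 (Finset.union_subset hGD (hVD.trans hD'D)), Finset.sum_union]
      · congr 1
        · exact Finset.sum_congr rfl fun d hd => by simp [σ, hd]
        · exact Finset.sum_congr rfl fun d hd => by simp [σ, hVG d hd]
      · rw [Finset.disjoint_left]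
        exact fun d hd hd' => hVG d hd' hd

theorem natLog_two_add_one_le {M : ℕ} (hM : M ≠ 0) :
    ((Nat.log 2 M + 1 : ℕ) : ℝ) ≤ 1 + 2 * Real.log M := by
  have h1 : ((2 : ℝ) ^ Nat.log 2 M) ≤ M := by exact_mod_cast Nat.pow_log_le_self 2 hM
  have h2 := Real.log_le_log (by positivity) h1
  rw [Real.log_pow] at h2
  -- The factor 2 comes from `log 2 > 1 / 2`.
  have h3 := Real.log_two_gt_d9
  have h4 : (0 : ℝ) ≤ Nat.log 2 M := Nat.cast_nonneg _
  push_cast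
  nlinarith

theorem rounding_error_le {M : ℕ} (hM : M ≠ 0) {ε : ℝ} (hg : g C M ≤ ε / 8) :
    9 * (C : ℝ) + 5 * C * (Nat.log 2 M + 1 : ℕ) ≤ ε / 8 * M := by
  have hM0 : (0 : ℝ) < M := by exact_mod_cast Nat.pos_of_ne_zero hM
  have hlog : 0 ≤ Real.log M := Real.log_natCast_nonneg M
  unfold g at hg
  rw [← mul_div_assoc, div_le_iff₀ hM0] at hg
  have hk := natLog_two_add_one_le hM
  have hC0 : (0 : ℝ) ≤ C := Nat.cast_nonneg C
  have hCC : (C : ℝ) ≤ (C : ℝ) ^ 2 := by exact_mod_cast Nat.le_self_pow two_ne_zero C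
  have h1 : 5 * (C : ℝ) * (Nat.log 2 M + 1 : ℕ) ≤ 5 * C * (1 + 2 * Real.log M) :=
    mul_le_mul_of_nonneg_left hk (by positivity)
  have h2 : 0 ≤ (C : ℝ) * (40 * (C : ℝ) ^ 2 + 90 * (C : ℝ) ^ 2 * Real.log M) := by positivity
  have h3 : (C : ℝ) * Real.log M ≤ (C : ℝ) ^ 2 * Real.log M := mul_le_mul_of_nonneg_right hCC hlog
  have h4 : 0 ≤ (C : ℝ) * Real.log M := by positivity
  linarith

end CJRP

theorem mainTheorem4 {N T C : ℕ} (I : CJRP N T C)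
    (hp : ∀ d ∈ I.D, I.p d = 0)
    (ε : ℝ) (hε : 0 < ε) (M : ℕ)
    (hg : ∀ m : ℝ, (M : ℝ) ≤ m → CJRP.g C m ≤ ε / 8 ∧ deriv (CJRP.g C) m < 0)
    (hM : 50 * (C : ℝ) / ε < (M : ℝ))
    (hopt : ∀ z : CJRPVars N T, I.IsOptimal z → M ≤ z.numOrders)
    (G : CJRP.SideInfo N T) (hG : G.IsCorrect I M)
    (z : CJRPVars N T) (hz : I.AugFeasible G z) :
    ∃ z' : CJRPVars N T,
      I.AugFeasible G z' ∧ z'.IsIntegral I.D ∧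
      I.cost z' ≤ ENNReal.ofReal (1 + ε / 8) * I.cost z ∧
      (∀ d ∈ I.D, (z.r d = 0 → z'.r d = 0) ∧ (z.r d = 1 → z'.r d = 1)) := by
  classical
  obtain ⟨-, -, hGO, -, -, hGD, hGd, -, -⟩ := hG
  have hM0 : (0 : ℝ) < M := lt_of_le_of_lt (by positivity) hM
  have hMne : M ≠ 0 := by
    rintro rfl
    simp at hM0
  have hf := hz.feasible
  have herr := CJRP.rounding_error_le hMne (hg M le_rfl).1
  obtain ⟨e₀, he₀, hemin⟩ := Finset.exists_min_image G.orders (fun e => I.K e.1)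
    (Finset.card_pos.1 (by omega))
  obtain ⟨d₀, hd₀, hdmin⟩ := Finset.exists_min_image G.demands (fun d => I.H d (G.time d))
    (Finset.card_pos.1 (by omega))
  have hε8 : ENNReal.ofReal (1 + ε / 8) ≠ 0 := by
    rw [ne_eq, ENNReal.ofReal_eq_zero]
    linarith
  -- For infinite LP cost any integral solution will do, so the rounding is run with zero holding
  -- costs.
  by_cases htop : I.cost z = ⊤
  · obtain ⟨z', -, -, -, -, h1, h2, h3, -⟩ := CJRP.exists_augFeasible_integral I hp G hGD z hz e₀
      he₀ (fun _ _ => 0) (by simp) (by simp) 0 le_rfl (by simp) 0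
    refine ⟨z', h1, h2, ?_, h3⟩
    rw [htop, ENNReal.mul_top hε8]
    exact le_top
  -- the parts of the cost of `z`
  have htime : ∀ d ∈ G.demands, G.time d ≤ d.2 := fun d hd => by
    by_contra hcon
    have := hf.deadline d (hGD hd) _ (not_le.1 hcon)
    rw [hz.serve_one d hd] at this
    exact one_ne_zero this
  have hserveG : ∀ d ∈ G.demands, I.H d (G.time d) ≤
      ∑ s ∈ Finset.Iic d.2, I.H d s * ENNReal.ofReal (z.x d s) := fun d hd => by
    refine le_trans (le_of_eq ?_) (Finset.single_le_sum
      (f := fun s => I.H d s * ENNReal.ofReal (z.x d s)) (fun _ _ => zero_le)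
      (Finset.mem_Iic.2 (htime d hd)))
    rw [hz.serve_one d hd, ENNReal.ofReal_one, mul_one]
  have hGtop : ∀ d ∈ G.demands, I.H d (G.time d) ≠ ⊤ := fun d hd => by
    refine ne_top_of_le_ne_top htop ((hserveG d hd).trans ?_)
    unfold CJRP.cost
    refine le_trans ?_ le_self_add
    refine le_trans ?_ le_add_self
    exact Finset.single_le_sum
      (f := fun d => ∑ s ∈ Finset.Iic d.2, I.H d s * ENNReal.ofReal (z.x d s))
      (fun _ _ => zero_le) (hGD hd)
  -- Truncation at the smallest guessed holding cost makes all costs real and bounded by `η`. It is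
  -- inactive at the services chosen, by `hVH`.
  set Hm := I.H d₀ (G.time d₀) with hHm
  have hHmtop : Hm ≠ ⊤ := hGtop d₀ hd₀
  have hmin : ∀ d s, min (I.H d s) Hm ≠ ⊤ := fun d s => ne_top_of_le_ne_top hHmtop (min_le_right _ _)
  obtain ⟨z', a, D', V, τ, h1, h2, h3, ha0, hD'D, hD'G, hVD', hV, hcost, ha⟩ :=
    CJRP.exists_augFeasible_integral I hp G hGD z hz e₀ he₀
      (fun d s => (min (I.H d s) Hm).toReal) (fun _ _ _ => ENNReal.toReal_nonneg)
      (fun d hd s s' hs hs' => ENNReal.toReal_mono (hmin _ _)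
        (min_le_min_right _ (I.H_antitone d hd s s' hs hs')))
      Hm.toReal ENNReal.toReal_nonneg
      (fun d _ s => ENNReal.toReal_mono hHmtop (min_le_right _ _)) (Nat.log 2 M + 1)
  refine ⟨z', h1, h2, ?_, h3⟩
  set OC := ∑ i, (I.K i : ℝ) * ∑ s, min (z.y i s) 1 with hOC
  set DC := ∑ d ∈ D', ∑ s ∈ Finset.Iic d.2, z.x d s * (min (I.H d s) Hm).toReal with hDC
  set GC := ∑ d ∈ G.demands, (I.H d (G.time d)).toReal with hGC
  have hxD' : ∀ d ∈ D', ∀ s, 0 ≤ z.x d s := fun d hd => hf.x_nonneg d (hD'D hd)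
  have hOC0 : 0 ≤ OC := Finset.sum_nonneg fun i _ => mul_nonneg (I.K i).coe_nonneg
    (Finset.sum_nonneg fun s _ => le_min (hf.y_nonneg i s) zero_le_one)
  have hDC0 : 0 ≤ DC := Finset.sum_nonneg fun d hd => Finset.sum_nonneg fun s _ =>
    mul_nonneg (hxD' d hd s) ENNReal.toReal_nonneg
  have hGC0 : 0 ≤ GC := Finset.sum_nonneg fun d _ => ENNReal.toReal_nonneg
  have hGCof : ENNReal.ofReal GC = ∑ d ∈ G.demands, I.H d (G.time d) := by
    rw [hGC, ENNReal.ofReal_sum_of_nonneg fun _ _ => ENNReal.toReal_nonneg]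
    exact Finset.sum_congr rfl fun d hd => ENNReal.ofReal_toReal (hGtop d hd)
  have hlow : ENNReal.ofReal (OC + DC + GC) ≤ I.cost z := by
    rw [ENNReal.ofReal_add (add_nonneg hOC0 hDC0) hGC0, ENNReal.ofReal_add hOC0 hDC0, hGCof,
      add_assoc]
    unfold CJRP.cost
    refine le_trans ?_ le_self_add
    refine add_le_add ?_ ?_
    · rw [hOC, ENNReal.ofReal_sum_of_nonneg fun i _ => mul_nonneg (I.K i).coe_nonneg
        (Finset.sum_nonneg fun s _ => le_min (hf.y_nonneg i s) zero_le_one)]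
      refine Finset.sum_le_sum fun i _ => ?_
      rw [ENNReal.ofReal_mul (I.K i).coe_nonneg, ENNReal.ofReal_coe_nnreal, ← Finset.mul_sum,
        ENNReal.ofReal_sum_of_nonneg fun s _ => le_min (hf.y_nonneg i s) zero_le_one]
      gcongr
      exact min_le_left _ _
    · have hsub : ∑ d ∈ D' ∪ G.demands, ∑ s ∈ Finset.Iic d.2, I.H d s * ENNReal.ofReal (z.x d s) ≤
          ∑ d ∈ I.D, ∑ s ∈ Finset.Iic d.2, I.H d s * ENNReal.ofReal (z.x d s) :=
        Finset.sum_le_sum_of_subset (Finset.union_subset hD'D hGD)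
      refine le_trans ?_ hsub
      rw [Finset.sum_union hD'G]
      refine add_le_add ?_ (Finset.sum_le_sum hserveG)
      rw [hDC, ENNReal.ofReal_sum_of_nonneg fun d hd => Finset.sum_nonneg fun s _ =>
        mul_nonneg (hxD' d hd s) ENNReal.toReal_nonneg]
      refine Finset.sum_le_sum fun d hd => ?_
      rw [ENNReal.ofReal_sum_of_nonneg fun s _ =>
        mul_nonneg (hxD' d hd s) ENNReal.toReal_nonneg]
      refine Finset.sum_le_sum fun s _ => ?_
      rw [ENNReal.ofReal_mul (hxD' d hd s), ENNReal.ofReal_toReal (hmin d s), mul_comm]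
      exact mul_le_mul_left (min_le_left _ _) _
  have hVH : ∑ d ∈ V, I.H d (τ d) =
      ENNReal.ofReal (∑ d ∈ V, (min (I.H d (τ d)) Hm).toReal) := by
    rw [ENNReal.ofReal_sum_of_nonneg fun _ _ => ENNReal.toReal_nonneg]
    refine Finset.sum_congr rfl fun d hd => ?_
    have hdD' := hVD' hd
    obtain ⟨hτ, s, hs, hx⟩ := hV d hd
    have hle : I.H d s ≤ Hm := by
      by_contra hcon
      exact hx.ne' (hz.serve_zero d (hD'D hdD') (Finset.disjoint_left.1 hD'G hdD') s
        (hs.trans hτ) ⟨d₀, hd₀, not_le.1 hcon⟩)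
    have hle' := (I.H_antitone d (hD'D hdD') s (τ d) hs hτ).trans hle
    rw [min_eq_left hle', ENNReal.ofReal_toReal (ne_top_of_le_ne_top hHmtop hle')]
  -- The `M` guessed orders are placed in full, each at no less than the cost of `e₀`.
  have hκ : M * (I.K e₀.1 : ℝ) ≤ OC := by
    have e1 : ∑ e ∈ G.orders, (I.K e.1 : ℝ) * min (z.y e.1 e.2) 1 ≤ OC := by
      rw [hOC]
      simp only [Finset.mul_sum]
      rw [← Finset.sum_product', Finset.univ_product_univ]
      exact Finset.sum_le_sum_of_subset_of_nonneg (Finset.subset_univ _) fun e _ _ =>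
        mul_nonneg (I.K e.1).coe_nonneg (le_min (hf.y_nonneg _ _) zero_le_one)
    refine le_trans ?_ e1
    rw [← hGO, ← nsmul_eq_mul]
    refine Finset.card_nsmul_le_sum _ _ _ fun e he => ?_
    rw [hz.order_one e he, min_self, mul_one]
    exact_mod_cast hemin e he
  have hη : M * Hm.toReal ≤ GC := by
    rw [← hGd, ← nsmul_eq_mul]
    exact Finset.card_nsmul_le_sum _ _ _ fun d hd => ENNReal.toReal_mono (hGtop d hd) (hdmin d hd)
  -- As `M < 2 ^ k`, each of `OC / 2 ^ k` and `κ` is at most `OC / M`, and `η` is at most `GC / M`.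
  -- The coefficients are `8 * C + 5 * C * k` and `C`.
  have hfinal : C * (2 * (OC / 2 ^ (Nat.log 2 M + 1) + 3 * (I.K e₀.1 : ℝ))) +
      5 * C * (Nat.log 2 M + 1 : ℕ) * I.K e₀.1 + C * Hm.toReal ≤ ε / 8 * (OC + GC) := by
    set k := Nat.log 2 M + 1
    have hC0 : (0 : ℝ) ≤ C := Nat.cast_nonneg C
    have hk0 : (0 : ℝ) ≤ k := Nat.cast_nonneg k
    have e1 : OC / 2 ^ k ≤ OC / M := by
      refine div_le_div_of_nonneg_left hOC0 hM0 ?_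
      exact_mod_cast (Nat.lt_pow_succ_log_self one_lt_two M).le
    have e2 : (I.K e₀.1 : ℝ) ≤ OC / M := by
      rw [le_div_iff₀ hM0, mul_comm]
      exact hκ
    have e3 : Hm.toReal ≤ GC / M := by
      rw [le_div_iff₀ hM0, mul_comm]
      exact hη
    have e4 : 0 ≤ OC / M := by positivity
    have e5 : 0 ≤ GC / M := by positivity
    calc C * (2 * (OC / 2 ^ k + 3 * (I.K e₀.1 : ℝ))) + 5 * C * k * I.K e₀.1 + C * Hm.toReal
        ≤ C * (2 * (OC / M + 3 * (OC / M))) + 5 * C * k * (OC / M) + C * (GC / M) := by gcongr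
      _ ≤ (9 * C + 5 * C * k) * (OC / M + GC / M) := by
        have := mul_nonneg hC0 e4
        have := mul_nonneg hC0 e5
        have := mul_nonneg (mul_nonneg hC0 hk0) e5
        linarith
      _ ≤ (ε / 8 * M) * (OC / M + GC / M) := mul_le_mul_of_nonneg_right herr (add_nonneg e4 e5)
      _ = ε / 8 * (OC + GC) := by field_simp
  refine le_trans ?_ (mul_le_mul_right hlow _)
  rw [← ENNReal.ofReal_mul (by linarith), hcost, hVH, ← hGCof]
  have hVC0 : 0 ≤ ∑ d ∈ V, (min (I.H d (τ d)) Hm).toReal :=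
    Finset.sum_nonneg fun _ _ => ENNReal.toReal_nonneg
  rw [← ENNReal.ofReal_add ha0 hGC0, ← ENNReal.ofReal_add (add_nonneg ha0 hGC0) hVC0]
  refine ENNReal.ofReal_le_ofReal ?_
  have := mul_nonneg hε.le hDC0
  linarith
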